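/- For a finite graph $H$ let $\nu(H)$ be the maximum size of a set of pairwise edge-disjoint triangles of $H$. Let $p=p(n)\in[0,1]$, let $G_{n,p}$ be the binomial random graph on $n$ labelled vertices (each of the $\binom n2$ possible edges is present independently with probability $p$), and put $$d=d(n)=(n-2)p^2,\qquad m=m(n)=\binom n2 p,\qquad \xi(x)=\tfrac13\left[1-(2x+1)^{-1/2}\right].$$ If $d=\Theta(1)$ as $n\to\infty$ (that is, there are constants $0<c\le C$ with $c\le d(n)\le C$ for all sufficiently large $n$), then with high probability $$\nu(G_{n,p})>(1-o(1))\,\xi(d)\,m;$$ that is, there is a sequence $\delta_n\to0$ such that $\Pr\bigl[\nu(G_{n,p})>(1-\delta_n)\,\xi(d(n))\,m(n)\bigr]\to1$ as $n\to\infty$. -/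

import Mathlib

open Filter Topology Asymptotics

/-- A triangle-matching of `G`: a finite set `M` of triangles of `G` (each given by its set of
three pairwise adjacent vertices) that are pairwise edge-disjoint, i.e. two distinct members of
`M` have at most one vertex in common. -/
def SimpleGraph.IsTriangleMatching {V : Type*} (G : SimpleGraph V) (M : Finset (Finset V)) :
    Prop :=
  (∀ t ∈ M, G.IsNClique 3 t) ∧
    (M : Set (Finset V)).Pairwise fun s t => ((s : Set V) ∩ (t : Set V)).Subsingleton

/-- `ν(G)`, the maximum size of a set of edge-disjoint triangles of the finite graph `G`. -/
noncomputable def SimpleGraph.triangleMatchingNumber {V : Type*} (G : SimpleGraph V) : ℕ :=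
  sSup {k : ℕ | ∃ M : Finset (Finset V), G.IsTriangleMatching M ∧ M.card = k}

/-- On a finite vertex set the supremum defining `ν(G)` is a maximum. -/
theorem SimpleGraph.isGreatest_triangleMatchingNumber {V : Type*} [Finite V]
    (G : SimpleGraph V) :
    IsGreatest {k : ℕ | ∃ M : Finset (Finset V), G.IsTriangleMatching M ∧ M.card = k}
      G.triangleMatchingNumber := by
  have := Fintype.ofFinite V
  have hb : BddAbove {k : ℕ | ∃ M : Finset (Finset V), G.IsTriangleMatching M ∧ M.card = k} := by
    refine ⟨Fintype.card (Finset V), ?_⟩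
    rintro k ⟨M, -, rfl⟩
    exact Finset.card_le_univ M
  have hne : {k : ℕ | ∃ M : Finset (Finset V), G.IsTriangleMatching M ∧ M.card = k}.Nonempty :=
    ⟨0, ∅, ⟨by simp, by simp⟩, rfl⟩
  exact ⟨Nat.sSup_mem hne hb, fun k hk => le_csSup hb hk⟩

/-- `d = (n - 2) p²`, the expected number of triangles of `G(n, p)` on a given edge. -/
def expectedTrianglesOnEdge (n : ℕ) (p : ℝ) : ℝ := ((n : ℝ) - 2) * p ^ 2

/-- `m = C(n, 2) p`, the expected number of edges of `G(n, p)`. -/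
def expectedEdges (n : ℕ) (p : ℝ) : ℝ := (n.choose 2 : ℝ) * p

/-- `ξ(d) = (1/3) [1 - (2d + 1)^(-1/2)]`. -/
noncomputable def xi (d : ℝ) : ℝ := (1 / 3 : ℝ) * (1 - (2 * d + 1) ^ (-(1 / 2) : ℝ))

/-!
Random greedy removal: repeatedly draw a uniformly random triangle of the complete graph and, if all
of its edges are still present, delete them. The triangles deleted are edge-disjoint, so the
expected number of deleted edges is at most `3 𝔼 ν`, and it suffices to follow the probability that
an edge survives.

After `i` draws, at time `t = i / N` with `N = C(n, 3)`, the probability that a set `S` of edges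
survives is approximately `p ^ |S| f(t) ^ |S| g(t) ^ τ(S)`, where `τ(S)` counts the
triangles inside `S`: the factor `g(t) = exp (-t)` is the probability that a given triangle has not
been drawn, and `f' = -d exp (-t) f ^ 3` because an edge is lost through one of the `d / p ^ 2`
triangles on it, the other two edges of which have to be alive. Hence `f` decreases to
`(1 + 2 d) ^ (-1/2)`, and the fraction of edges deleted tends to `3 ξ(d)`. The error for sets of `k`
edges is governed by the errors for sets of `k + 2` edges; this hierarchy is closed, as in Lanford's
derivation of the Boltzmann equation, by iterating over short blocks of time with the trivial bound
for the largest sets.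

The matching number changes by at most one when one edge is added, so the Efron–Stein and Chebyshev
inequalities turn the bound on `𝔼 ν` into one with high probability.
-/

section BernoulliMean

open Finset

variable {α : Type*} [DecidableEq α]

/-- The expectation of a function of the random subset of `X` that contains each element of `X`
independently with probability `p`, as a linear functional of the function. -/
noncomputable def bernoulliMean (p : ℝ) (X : Finset α) : (Finset α → ℝ) →ₗ[ℝ] ℝ :=
  ∑ A ∈ X.powerset, (p ^ #A * (1 - p) ^ #(X \ A)) • LinearMap.proj A

/-- The indicator function of the event that a random set contains `S`. -/
def supersetIndicator (S A : Finset α) : ℝ := if S ⊆ A then 1 else 0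

theorem bernoulliMean_apply (p : ℝ) (X : Finset α) (F : Finset α → ℝ) :
    bernoulliMean p X F = ∑ A ∈ X.powerset, p ^ #A * (1 - p) ^ #(X \ A) * F A := by
  simp [bernoulliMean]

theorem bernoulliMean_congr (p : ℝ) {X : Finset α} {F F' : Finset α → ℝ}
    (h : ∀ A ⊆ X, F A = F' A) : bernoulliMean p X F = bernoulliMean p X F' := by
  simp only [bernoulliMean_apply]
  exact sum_congr rfl fun A hA => by rw [h A (mem_powerset.1 hA)]

theorem bernoulliMean_empty (p : ℝ) (F : Finset α → ℝ) : bernoulliMean p ∅ F = F ∅ := by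
  simp [bernoulliMean_apply]

theorem bernoulliMean_insert (p : ℝ) {X : Finset α} {x : α} (hx : x ∉ X) (F : Finset α → ℝ) :
    bernoulliMean p (insert x X) F =
      p * bernoulliMean p X (fun A => F (insert x A)) + (1 - p) * bernoulliMean p X F := by
  simp only [bernoulliMean_apply]
  rw [sum_powerset_insert hx, add_comm, mul_sum, mul_sum]
  congr 1 <;> refine sum_congr rfl fun A hA => ?_ <;>
    have hxA : x ∉ A := fun h => hx (mem_powerset.1 hA h)
  · rw [card_insert_of_notMem hxA, insert_sdiff_insert, sdiff_insert_of_notMem hx]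
    ring
  · rw [insert_sdiff_of_notMem _ hxA, card_insert_of_notMem (by simp [hx])]
    ring

theorem bernoulliMean_const (p c : ℝ) (X : Finset α) : bernoulliMean p X (fun _ => c) = c := by
  induction X using Finset.induction_on with
  | empty => rw [bernoulliMean_empty]
  | insert x X hx ih => rw [bernoulliMean_insert p hx, ih]; ring

theorem bernoulliMean_supersetIndicator (p : ℝ) {X S : Finset α} (hS : S ⊆ X) :
    bernoulliMean p X (supersetIndicator S) = p ^ #S := by
  induction X using Finset.induction_on generalizing S with
  | empty => simp [bernoulliMean_empty, supersetIndicator, subset_empty.1 hS]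
  | insert x X hx ih =>
    rw [bernoulliMean_insert p hx]
    by_cases hxS : x ∈ S
    · have without : bernoulliMean p X (supersetIndicator S) = 0 := by
        have vanishes : ∀ A ⊆ X, supersetIndicator S A = 0 := fun A hA =>
          if_neg fun h => hx (hA (h hxS))
        rw [bernoulliMean_congr p vanishes, bernoulliMean_const]
      have withx : (fun A => supersetIndicator S (insert x A)) = supersetIndicator (S.erase x) := by
        simp only [supersetIndicator, subset_insert_iff, funext_iff, implies_true]
      rw [without, withx, ih (subset_insert_iff.1 hS), ← card_erase_add_one hxS]
      ring
    · have withx : (fun A => supersetIndicator S (insert x A)) = supersetIndicator S := by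
        simp only [supersetIndicator, subset_insert_iff_of_notMem hxS, funext_iff, implies_true]
      rw [withx, ih ((subset_insert_iff_of_notMem hxS).1 hS)]
      ring

theorem sum_supersetIndicator_singleton (X A : Finset α) :
    ∑ x ∈ X, supersetIndicator {x} A = #(X ∩ A) := by
  simp [supersetIndicator, sum_ite_mem]

theorem bernoulliMean_card_inter (p : ℝ) (X : Finset α) :
    bernoulliMean p X (fun A => (#(X ∩ A) : ℝ)) = #X * p := by
  have card_eq : (fun A => (#(X ∩ A) : ℝ)) = ∑ x ∈ X, supersetIndicator {x} := by
    ext A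
    rw [Finset.sum_apply, sum_supersetIndicator_singleton]
  rw [card_eq, map_sum, sum_congr rfl fun x hx =>
    bernoulliMean_supersetIndicator p (singleton_subset_iff.2 hx)]
  simp

theorem bernoulliMean_mono {p : ℝ} (hp₀ : 0 ≤ p) (hp₁ : p ≤ 1) {X : Finset α}
    {F F' : Finset α → ℝ} (h : ∀ A ⊆ X, F A ≤ F' A) :
    bernoulliMean p X F ≤ bernoulliMean p X F' := by
  simp only [bernoulliMean_apply]
  have := sub_nonneg.2 hp₁
  exact sum_le_sum fun A hA => mul_le_mul_of_nonneg_left (h A (mem_powerset.1 hA)) (by positivity)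

theorem bernoulliMean_nonneg {p : ℝ} (hp₀ : 0 ≤ p) (hp₁ : p ≤ 1) {X : Finset α}
    {F : Finset α → ℝ} (h : ∀ A ⊆ X, 0 ≤ F A) : 0 ≤ bernoulliMean p X F :=
  (bernoulliMean_const p 0 X).ge.trans (bernoulliMean_mono hp₀ hp₁ h)

theorem abs_bernoulliMean_le {p : ℝ} (hp₀ : 0 ≤ p) (hp₁ : p ≤ 1) {X : Finset α}
    {F : Finset α → ℝ} {c : ℝ} (h : ∀ A ⊆ X, |F A| ≤ c) : |bernoulliMean p X F| ≤ c :=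
  abs_le.2
    ⟨(bernoulliMean_const p (-c) X).ge.trans
        (bernoulliMean_mono hp₀ hp₁ fun A hA => (abs_le.1 (h A hA)).1),
      (bernoulliMean_mono hp₀ hp₁ fun A hA => (abs_le.1 (h A hA)).2).trans
        (bernoulliMean_const p c X).le⟩

/-- The variance of a function of the random subset of `X` that contains each element of `X`
independently with probability `p`. -/
noncomputable def bernoulliVariance (p : ℝ) (X : Finset α) (F : Finset α → ℝ) : ℝ :=
  bernoulliMean p X (F ^ 2) - bernoulliMean p X F ^ 2

theorem bernoulliVariance_insert (p : ℝ) {X : Finset α} {x : α} (hx : x ∉ X)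
    (F : Finset α → ℝ) :
    bernoulliVariance p (insert x X) F =
      p * bernoulliVariance p X (fun A => F (insert x A)) + (1 - p) * bernoulliVariance p X F +
        p * (1 - p) * bernoulliMean p X ((fun A => F (insert x A)) - F) ^ 2 := by
  simp only [bernoulliVariance, bernoulliMean_insert p hx, map_sub]
  simp only [Pi.pow_def]
  ring

theorem bernoulliVariance_le_efronStein {p : ℝ} (hp₀ : 0 ≤ p) (hp₁ : p ≤ 1) (X : Finset α)
    {F : Finset α → ℝ} {c : α → ℝ} (hF : ∀ x ∈ X, ∀ A ⊆ X, |F (insert x A) - F A| ≤ c x) :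
    bernoulliVariance p X F ≤ p * (1 - p) * ∑ x ∈ X, c x ^ 2 := by
  induction X using Finset.induction_on generalizing F with
  | empty => simp [bernoulliVariance, bernoulliMean_empty]
  | insert x X hx ih =>
    have hX : X ⊆ insert x X := subset_insert x X
    have without := ih fun y hy A hA => hF y (hX hy) A (hA.trans hX)
    have withx := ih (F := fun A => F (insert x A)) fun y hy A hA => by
      rw [Finset.insert_comm]
      exact hF y (hX hy) _ (insert_subset_insert x hA)
    have jump : bernoulliMean p X ((fun A => F (insert x A)) - F) ^ 2 ≤ c x ^ 2 :=
      have abs_le_c := abs_bernoulliMean_le hp₀ hp₁ (F := (fun A => F (insert x A)) - F)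
        fun A hA => hF x (mem_insert_self x X) A (hA.trans hX)
      sq_le_sq' (abs_le.1 abs_le_c).1 (abs_le.1 abs_le_c).2
    have := sub_nonneg.2 hp₁
    rw [bernoulliVariance_insert p hx, sum_insert hx]
    calc _ ≤ p * (p * (1 - p) * ∑ x ∈ X, c x ^ 2) + (1 - p) * (p * (1 - p) * ∑ x ∈ X, c x ^ 2) +
          p * (1 - p) * c x ^ 2 := by gcongr
      _ = _ := by ring

theorem bernoulliMean_lower_tail_le_chebyshev {p : ℝ} (hp₀ : 0 ≤ p) (hp₁ : p ≤ 1) (X : Finset α)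
    (F : Finset α → ℝ) {s : ℝ} (hs : 0 < s) :
    bernoulliMean p X (Set.indicator {A | F A ≤ bernoulliMean p X F - s} 1) ≤
      bernoulliVariance p X F / s ^ 2 := by
  set μ := bernoulliMean p X F
  have variance_eq : bernoulliVariance p X F = bernoulliMean p X (fun A => (F A - μ) ^ 2) := by
    have expand : (fun A => (F A - μ) ^ 2) = F ^ 2 - (2 * μ) • F + fun _ => μ ^ 2 := by
      ext A
      simp only [Pi.add_apply, Pi.sub_apply, Pi.pow_apply, Pi.smul_apply, smul_eq_mul]
      ring
    rw [expand, map_add, map_sub, map_smul, bernoulliMean_const, smul_eq_mul, bernoulliVariance]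
    ring
  rw [le_div_iff₀ (by positivity), mul_comm, variance_eq, ← smul_eq_mul, ← map_smul]
  refine bernoulliMean_mono hp₀ hp₁ fun A _ => ?_
  by_cases hA : F A ≤ μ - s
  · have : s ^ 2 ≤ (F A - μ) ^ 2 := by nlinarith
    simpa [hA] using this
  · simpa [hA] using sq_nonneg (F A - μ)

end BernoulliMean

section Packing

open Finset

variable {α : Type*}

/-- `M` is a packing of `𝒯` in `A`: a set of pairwise disjoint members of `𝒯` contained in `A`. -/
structure IsPacking (𝒯 : Finset (Finset α)) (A : Finset α) (M : Finset (Finset α)) : Prop where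
  subset : M ⊆ 𝒯
  subset_of_mem : ∀ T ∈ M, T ⊆ A
  pairwiseDisjoint : (M : Set (Finset α)).PairwiseDisjoint id

open scoped Classical in
/-- The largest size of a packing of `𝒯` in `A`. -/
noncomputable def packingNumber (𝒯 : Finset (Finset α)) (A : Finset α) : ℕ :=
  (𝒯.powerset.filter (IsPacking 𝒯 A)).sup card

variable {𝒯 : Finset (Finset α)} {A B T : Finset α}

theorem IsPacking.card_le_packingNumber {M : Finset (Finset α)} (hM : IsPacking 𝒯 A M) :
    #M ≤ packingNumber 𝒯 A := by
  classical
  exact le_sup (f := card) (mem_filter.2 ⟨mem_powerset.2 hM.subset, hM⟩)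

theorem exists_isPacking_card_eq (𝒯 : Finset (Finset α)) (A : Finset α) :
    ∃ M, IsPacking 𝒯 A M ∧ #M = packingNumber 𝒯 A := by
  classical
  have hne : (𝒯.powerset.filter (IsPacking 𝒯 A)).Nonempty :=
    ⟨∅, by simp [show IsPacking 𝒯 A ∅ from ⟨by simp, by simp, by simp⟩]⟩
  obtain ⟨M, hM, hcard⟩ := exists_mem_eq_sup _ hne card
  exact ⟨M, (mem_filter.1 hM).2, hcard.symm⟩

theorem packingNumber_mono (h : A ⊆ B) : packingNumber 𝒯 A ≤ packingNumber 𝒯 B := by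
  obtain ⟨M, hM, hcard⟩ := exists_isPacking_card_eq 𝒯 A
  rw [← hcard]
  exact IsPacking.card_le_packingNumber
    ⟨hM.subset, fun T hT => (hM.subset_of_mem T hT).trans h, hM.pairwiseDisjoint⟩

variable [DecidableEq α]

theorem packingNumber_sdiff_add_one_le (hT : T ∈ 𝒯) (hTA : T ⊆ A) (hne : T.Nonempty) :
    packingNumber 𝒯 (A \ T) + 1 ≤ packingNumber 𝒯 A := by
  obtain ⟨M, hM, hcard⟩ := exists_isPacking_card_eq 𝒯 (A \ T)
  have disj : ∀ T' ∈ M, Disjoint T T' := fun T' hT' =>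
    disjoint_sdiff.mono_right (hM.subset_of_mem T' hT')
  have hTM : T ∉ M := fun h => hne.ne_empty (disjoint_self.1 (disj T h))
  rw [← hcard, ← card_insert_of_notMem hTM]
  refine IsPacking.card_le_packingNumber ⟨insert_subset hT hM.subset, ?_, ?_⟩
  · simp only [forall_mem_insert]
    exact ⟨hTA, fun T' hT' => (hM.subset_of_mem T' hT').trans sdiff_subset⟩
  · rw [coe_insert, Set.pairwiseDisjoint_insert]
    exact ⟨hM.pairwiseDisjoint, fun T' hT' _ => disj T' hT'⟩

theorem packingNumber_insert_le (x : α) (A : Finset α) :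
    packingNumber 𝒯 (insert x A) ≤ packingNumber 𝒯 A + 1 := by
  obtain ⟨M, hM, hcard⟩ := exists_isPacking_card_eq 𝒯 (insert x A)
  have avoid : IsPacking 𝒯 A (M.filter (x ∉ ·)) :=
    ⟨(filter_subset _ _).trans hM.subset, fun T hT =>
      (subset_insert_iff_of_notMem (mem_filter.1 hT).2).1 (hM.subset_of_mem T (mem_filter.1 hT).1),
      hM.pairwiseDisjoint.subset (coe_subset.2 (filter_subset _ _))⟩
  have contain : #(M.filter (x ∈ ·)) ≤ 1 := card_le_one.2 fun T hT T' hT' => by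
    rw [mem_filter] at hT hT'
    exact hM.pairwiseDisjoint.elim hT.1 hT'.1 (not_disjoint_iff.2 ⟨x, hT.2, hT'.2⟩)
  have split := card_filter_add_card_filter_not (s := M) (x ∈ ·)
  have := avoid.card_le_packingNumber
  omega

theorem abs_packingNumber_insert_sub_le (x : α) (A : Finset α) :
    |(packingNumber 𝒯 (insert x A) : ℝ) - packingNumber 𝒯 A| ≤ 1 := by
  have lower : (packingNumber 𝒯 A : ℝ) ≤ packingNumber 𝒯 (insert x A) := by
    exact_mod_cast packingNumber_mono (subset_insert x A)
  have upper : (packingNumber 𝒯 (insert x A) : ℝ) ≤ packingNumber 𝒯 A + 1 := by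
    exact_mod_cast packingNumber_insert_le x A
  rw [abs_le]
  constructor <;> linarith

end Packing

section GreedyRemoval

open Finset

variable {α : Type*} [DecidableEq α]

/-- One attempt of the greedy removal process: delete `T` if all of it is still there. -/
def removeIfSubset (T A : Finset α) : Finset α := if T ⊆ A then A \ T else A

/-- The transition operator of the greedy removal process: `greedyTransition 𝒯 F A` is the
expectation of `F` after attempting to remove a uniformly random member of `𝒯` from `A`. -/
noncomputable def greedyTransition (𝒯 : Finset (Finset α)) :
    (Finset α → ℝ) →ₗ[ℝ] (Finset α → ℝ) :=
  (#𝒯 : ℝ)⁻¹ • ∑ T ∈ 𝒯, LinearMap.funLeft ℝ ℝ (removeIfSubset T)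

/-- The probability that all of `S` survives `i` steps of the greedy removal process started from
the random subset of `X` that contains each element independently with probability `p`. -/
noncomputable def survival (p : ℝ) (X : Finset α) (𝒯 : Finset (Finset α)) (i : ℕ)
    (S : Finset α) : ℝ :=
  bernoulliMean p X ((greedyTransition 𝒯 ^ i) (supersetIndicator S))

theorem greedyTransition_apply (𝒯 : Finset (Finset α)) (F : Finset α → ℝ) (A : Finset α) :
    greedyTransition 𝒯 F A = (#𝒯 : ℝ)⁻¹ * ∑ T ∈ 𝒯, F (removeIfSubset T A) := by
  simp [greedyTransition]

theorem greedyTransition_mono (𝒯 : Finset (Finset α)) : Monotone (greedyTransition 𝒯) :=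
  fun F F' h A => by
    rw [greedyTransition_apply, greedyTransition_apply]
    gcongr
    exact h _

theorem greedyTransition_pow_mono (𝒯 : Finset (Finset α)) (i : ℕ) :
    Monotone (greedyTransition 𝒯 ^ i) := by
  rw [Module.End.coe_pow]
  exact (greedyTransition_mono 𝒯).iterate i

theorem le_greedyTransition_pow {𝒯 : Finset (Finset α)} {F : Finset α → ℝ}
    (hF : F ≤ greedyTransition 𝒯 F) (i : ℕ) : F ≤ (greedyTransition 𝒯 ^ i) F := by
  rw [Module.End.coe_pow]
  exact (greedyTransition_mono 𝒯).monotone_iterate_of_le_map hF i.zero_le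

theorem supersetIndicator_nonneg (S : Finset α) : 0 ≤ supersetIndicator S := fun A => by
  unfold supersetIndicator
  positivity

theorem supersetIndicator_removeIfSubset (S T A : Finset α) :
    supersetIndicator S (removeIfSubset T A) =
      supersetIndicator S A - if Disjoint S T then 0 else supersetIndicator (S ∪ T) A := by
  simp only [supersetIndicator, removeIfSubset, union_subset_iff]
  by_cases hT : T ⊆ A
  · by_cases hS : Disjoint S T <;> simp [hT, hS, subset_sdiff]
  · simp [hT]

theorem greedyTransition_supersetIndicator {𝒯 : Finset (Finset α)} (h𝒯 : 𝒯.Nonempty)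
    (S : Finset α) :
    greedyTransition 𝒯 (supersetIndicator S) = supersetIndicator S -
      (#𝒯 : ℝ)⁻¹ • ∑ T ∈ 𝒯 with ¬Disjoint S T, supersetIndicator (S ∪ T) := by
  ext A
  have hN : (#𝒯 : ℝ) ≠ 0 := by exact_mod_cast h𝒯.card_pos.ne'
  simp only [greedyTransition_apply, supersetIndicator_removeIfSubset, sum_sub_distrib,
    Pi.sub_apply, Pi.smul_apply, Finset.sum_apply, smul_eq_mul, sum_const, nsmul_eq_mul,
    ← sum_filter, ← ite_not (Disjoint S _)]
  field_simp

variable {p : ℝ} {X T : Finset α} {𝒯 : Finset (Finset α)}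

theorem survival_succ (h𝒯 : 𝒯.Nonempty) (i : ℕ) (S : Finset α) :
    survival p X 𝒯 (i + 1) S = survival p X 𝒯 i S -
      (#𝒯 : ℝ)⁻¹ * ∑ T ∈ 𝒯 with ¬Disjoint S T, survival p X 𝒯 i (S ∪ T) := by
  simp only [survival, pow_succ, Module.End.mul_apply, greedyTransition_supersetIndicator h𝒯,
    map_sub, map_smul, map_sum, smul_eq_mul]

theorem survival_zero {S : Finset α} (hS : S ⊆ X) : survival p X 𝒯 0 S = p ^ #S :=
  bernoulliMean_supersetIndicator p hS

theorem survival_nonneg (hp₀ : 0 ≤ p) (hp₁ : p ≤ 1) (i : ℕ) (S : Finset α) :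
    0 ≤ survival p X 𝒯 i S :=
  bernoulliMean_nonneg hp₀ hp₁ fun A _ => by
    simpa using greedyTransition_pow_mono 𝒯 i (supersetIndicator_nonneg S) A

theorem survival_le (hp₀ : 0 ≤ p) (hp₁ : p ≤ 1) (h𝒯 : 𝒯.Nonempty) (i : ℕ) {S : Finset α}
    (hS : S ⊆ X) : survival p X 𝒯 i S ≤ p ^ #S := by
  induction i with
  | zero => rw [survival_zero hS]
  | succ i ih =>
    rw [survival_succ h𝒯]
    have loss_nonneg := sum_nonneg fun T (_ : T ∈ 𝒯.filter (¬Disjoint S ·)) =>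
      survival_nonneg (𝒯 := 𝒯) (X := X) hp₀ hp₁ i (S ∪ T)
    have : 0 ≤ (#𝒯 : ℝ)⁻¹ * ∑ T ∈ 𝒯 with ¬Disjoint S T, survival p X 𝒯 i (S ∪ T) := by positivity
    linarith

/-- The potential `|X ∩ A| - r * ν(A)` of the greedy removal process, where `ν` is the packing
number. It increases on average if the members of `𝒯` have size at most `r`. -/
noncomputable def packingDeficit (X : Finset α) (𝒯 : Finset (Finset α)) (r : ℕ)
    (A : Finset α) : ℝ :=
  #(X ∩ A) - r * packingNumber 𝒯 A

theorem packingDeficit_le_removeIfSubset {r : ℕ} (X A : Finset α) (hT : T ∈ 𝒯)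
    (hne : T.Nonempty) (hr : #T ≤ r) :
    packingDeficit X 𝒯 r A ≤ packingDeficit X 𝒯 r (removeIfSubset T A) := by
  unfold removeIfSubset
  split_ifs with hTA
  · have packed : (packingNumber 𝒯 (A \ T) : ℝ) + 1 ≤ packingNumber 𝒯 A := by
      exact_mod_cast packingNumber_sdiff_add_one_le hT hTA hne
    have removed : (#(X ∩ A) : ℝ) ≤ #(X ∩ (A \ T)) + r := by
      have := le_card_sdiff T (X ∩ A)
      rw [inter_sdiff_assoc] at this
      exact_mod_cast (by omega : #(X ∩ A) ≤ #(X ∩ (A \ T)) + r)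
    unfold packingDeficit
    nlinarith
  · exact le_rfl

theorem packingDeficit_le_greedyTransition {r : ℕ} (X : Finset α) (h𝒯 : 𝒯.Nonempty)
    (hne : ∀ T ∈ 𝒯, T.Nonempty) (hr : ∀ T ∈ 𝒯, #T ≤ r) :
    packingDeficit X 𝒯 r ≤ greedyTransition 𝒯 (packingDeficit X 𝒯 r) := fun A => by
  have hN : (0 : ℝ) < #𝒯 := by exact_mod_cast h𝒯.card_pos
  rw [greedyTransition_apply, ← div_eq_inv_mul, le_div_iff₀ hN, mul_comm, ← nsmul_eq_mul]
  exact card_nsmul_le_sum _ _ _ fun T hT =>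
    packingDeficit_le_removeIfSubset X A hT (hne T hT) (hr T hT)

theorem expected_removed_le_mul_packingNumber {p : ℝ} (hp₀ : 0 ≤ p) (hp₁ : p ≤ 1) {r : ℕ}
    (X : Finset α) (h𝒯 : 𝒯.Nonempty) (hne : ∀ T ∈ 𝒯, T.Nonempty) (hr : ∀ T ∈ 𝒯, #T ≤ r) (i : ℕ) :
    #X * p - ∑ x ∈ X, survival p X 𝒯 i {x} ≤
      r * bernoulliMean p X (fun A => (packingNumber 𝒯 A : ℝ)) := by
  have deficit_le : packingDeficit X 𝒯 r ≤ ∑ x ∈ X, supersetIndicator {x} := fun A => by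
    rw [Finset.sum_apply, sum_supersetIndicator_singleton, packingDeficit, sub_le_self_iff]
    positivity
  have deficit_le_alive := (le_greedyTransition_pow
    (packingDeficit_le_greedyTransition X h𝒯 hne hr) i).trans
    (greedyTransition_pow_mono 𝒯 i deficit_le)
  have mean_deficit : bernoulliMean p X (packingDeficit X 𝒯 r) =
      #X * p - r * bernoulliMean p X (fun A => (packingNumber 𝒯 A : ℝ)) := by
    rw [← bernoulliMean_card_inter, ← smul_eq_mul (r : ℝ), ← map_smul, ← map_sub]
    rfl
  have mean_le := bernoulliMean_mono hp₀ hp₁ (X := X) fun A _ => deficit_le_alive A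
  rw [mean_deficit, map_sum, map_sum] at mean_le
  unfold survival
  linarith

end GreedyRemoval

section TripleSystem

open Finset

variable {α : Type*} [DecidableEq α]

/-- A partial triple system: a family of triples, any two of which share at most one element. -/
structure IsPartialTripleSystem (𝒯 : Finset (Finset α)) : Prop where
  card_eq : ∀ T ∈ 𝒯, #T = 3
  pairwise_card_inter_le : (𝒯 : Set (Finset α)).Pairwise fun T T' => #(T ∩ T') ≤ 1

/-- A partial triple system of triples of elements of `X` in which every element of `X` lies in
exactly `D` triples. -/
structure IsRegularTripleSystem (X : Finset α) (𝒯 : Finset (Finset α)) (D : ℕ) : Prop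
    extends IsPartialTripleSystem 𝒯 where
  subset : ∀ T ∈ 𝒯, T ⊆ X
  degree : ∀ x ∈ X, #{T ∈ 𝒯 | x ∈ T} = D

/-- The number of triples of `𝒯` inside `S`. -/
def triplesInside (𝒯 : Finset (Finset α)) (S : Finset α) : ℕ := #{T ∈ 𝒯 | T ⊆ S}

/-- The triple `T` is pendant to `S`: it meets `S` in one element, and the union of `S` and `T`
contains no triple of `𝒯` other than `T` and those inside `S`. -/
def IsPendant (𝒯 : Finset (Finset α)) (S T : Finset α) : Prop :=
  #(S ∩ T) = 1 ∧ triplesInside 𝒯 (S ∪ T) = triplesInside 𝒯 S + 1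

instance (𝒯 : Finset (Finset α)) (S T : Finset α) : Decidable (IsPendant 𝒯 S T) :=
  inferInstanceAs (Decidable (_ ∧ _))

variable {X S T : Finset α} {𝒯 : Finset (Finset α)} {D : ℕ}

theorem IsPendant.not_disjoint (h : IsPendant 𝒯 S T) : ¬Disjoint S T := fun hdisj => by
  simpa [disjoint_iff_inter_eq_empty.1 hdisj] using h.1

namespace IsPartialTripleSystem

theorem eq_of_mem_of_mem (h : IsPartialTripleSystem 𝒯) {T' : Finset α} (hT : T ∈ 𝒯)
    (hT' : T' ∈ 𝒯) {x y : α} (hxy : x ≠ y) (hx : x ∈ T) (hy : y ∈ T) (hx' : x ∈ T')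
    (hy' : y ∈ T') : T = T' := by
  by_contra hne
  exact hxy (card_le_one.1 (h.pairwise_card_inter_le hT hT' hne) x (mem_inter.2 ⟨hx, hx'⟩) y
    (mem_inter.2 ⟨hy, hy'⟩))

theorem card_pair_subset_le (h : IsPartialTripleSystem 𝒯) (x y : α) :
    #{T ∈ 𝒯 | x ≠ y ∧ x ∈ T ∧ y ∈ T} ≤ 1 := by
  refine card_le_one.2 fun T hT T' hT' => ?_
  simp only [mem_filter] at hT hT'
  exact h.eq_of_mem_of_mem hT.1 hT'.1 hT.2.1 hT.2.2.1 hT.2.2.2 hT'.2.2.1 hT'.2.2.2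

theorem not_subset_of_card_inter_eq_one (h : IsPartialTripleSystem 𝒯) (hT : T ∈ 𝒯)
    (hST : #(S ∩ T) = 1) : ¬T ⊆ S := fun hsub => by
  rw [inter_eq_right.2 hsub, h.card_eq T hT] at hST
  omega

theorem card_union_of_isPendant (h : IsPartialTripleSystem 𝒯) (hT : T ∈ 𝒯)
    (hST : IsPendant 𝒯 S T) : #(S ∪ T) = #S + 2 := by
  have := card_union_add_card_inter S T
  rw [hST.1, h.card_eq T hT] at this
  omega

theorem card_two_le_card_inter_le (h : IsPartialTripleSystem 𝒯) (S : Finset α) :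
    #{T ∈ 𝒯 | 2 ≤ #(S ∩ T)} ≤ #S ^ 2 := by
  have two_elements : {T ∈ 𝒯 | 2 ≤ #(S ∩ T)} ⊆
      (S ×ˢ S).biUnion fun q => {T ∈ 𝒯 | q.1 ≠ q.2 ∧ q.1 ∈ T ∧ q.2 ∈ T} := fun T hT => by
    rw [mem_filter] at hT
    obtain ⟨x, hx, y, hy, hxy⟩ := one_lt_card.1 (Nat.lt_of_succ_le hT.2)
    rw [mem_inter] at hx hy
    exact mem_biUnion.2 ⟨(x, y), mem_product.2 ⟨hx.1, hy.1⟩, mem_filter.2 ⟨hT.1, hxy, hx.2, hy.2⟩⟩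
  calc _ ≤ _ := card_le_card two_elements
    _ ≤ #(S ×ˢ S) * 1 := card_biUnion_le_card_mul _ _ _ fun q _ => h.card_pair_subset_le q.1 q.2
    _ = #S ^ 2 := by rw [card_product]; ring

theorem triplesInside_le_sq (h : IsPartialTripleSystem 𝒯) (S : Finset α) :
    triplesInside 𝒯 S ≤ #S ^ 2 := by
  refine (card_le_card (monotone_filter_right 𝒯 fun T hT hTS => ?_)).trans
    (h.card_two_le_card_inter_le S)
  rw [inter_eq_right.2 hTS, h.card_eq T hT]
  norm_num

theorem exists_triple_linking (h : IsPartialTripleSystem 𝒯) (hT : T ∈ 𝒯) (hST : #(S ∩ T) = 1)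
    (hnp : ¬IsPendant 𝒯 S T) : ∃ T' ∈ 𝒯, 2 ≤ #(S ∩ T') ∧ ∃ x ∈ T', x ∈ T ∧ x ∉ S := by
  have hTS := h.not_subset_of_card_inter_eq_one hT hST
  obtain ⟨T', hT', hTT', hsub, hT'S⟩ : ∃ T' ∈ 𝒯, T' ≠ T ∧ T' ⊆ S ∪ T ∧ ¬T' ⊆ S := by
    by_contra! hnone
    have inside_union : {T' ∈ 𝒯 | T' ⊆ S ∪ T} = insert T {T' ∈ 𝒯 | T' ⊆ S} := by
      ext T'
      simp only [mem_filter, mem_insert]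
      refine ⟨fun hT' => or_iff_not_imp_left.2 fun hne => ⟨hT'.1, hnone T' hT'.1 hne hT'.2⟩, ?_⟩
      rintro (rfl | hT')
      · exact ⟨hT, subset_union_right⟩
      · exact ⟨hT'.1, hT'.2.trans subset_union_left⟩
    refine hnp ⟨hST, ?_⟩
    rw [triplesInside, inside_union, card_insert_of_notMem (by simp [hTS]), triplesInside]
  obtain ⟨x, hxT', hxS⟩ := not_subset.1 hT'S
  have hxT : x ∈ T := (mem_union.1 (hsub hxT')).resolve_left hxS
  refine ⟨T', hT', ?_, x, hxT', hxT, hxS⟩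
  have rest_subset : T'.erase x ⊆ S ∩ T' := fun y hy => by
    rw [mem_erase] at hy
    refine mem_inter.2 ⟨(mem_union.1 (hsub hy.2)).resolve_right fun hyT => hTT' ?_, hy.2⟩
    exact h.eq_of_mem_of_mem hT' hT hy.1 hy.2 hxT' hyT hxT
  have := card_le_card rest_subset
  rwa [card_erase_of_mem hxT', h.card_eq T' hT'] at this

theorem card_not_isPendant_le (h : IsPartialTripleSystem 𝒯) (S : Finset α) :
    #{T ∈ 𝒯 | ¬Disjoint S T ∧ ¬IsPendant 𝒯 S T} ≤ 4 * #S ^ 3 := by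
  set B : Finset (Finset α) := {T ∈ 𝒯 | 2 ≤ #(S ∩ T)}
  have card_B : #B ≤ #S ^ 2 := h.card_two_le_card_inter_le S
  set P : Finset (Finset α) := S.biUnion fun s => B.biUnion fun T' => T'.biUnion fun x =>
    {T ∈ 𝒯 | s ≠ x ∧ s ∈ T ∧ x ∈ T}
  have cover : {T ∈ 𝒯 | ¬Disjoint S T ∧ ¬IsPendant 𝒯 S T} ⊆ B ∪ P := by
    intro T hT
    obtain ⟨hT, hmeet, hnp⟩ := mem_filter.1 hT
    obtain ⟨s, hsS, hsT⟩ := not_disjoint_iff.1 hmeet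
    rw [mem_union, or_iff_not_imp_left]
    intro hTB
    have hST : #(S ∩ T) = 1 := by
      have := card_pos.2 ⟨s, mem_inter.2 ⟨hsS, hsT⟩⟩
      have : ¬2 ≤ #(S ∩ T) := fun hle => hTB (mem_filter.2 ⟨hT, hle⟩)
      omega
    obtain ⟨T', hT', hST', x, hxT', hxT, hxS⟩ := h.exists_triple_linking hT hST hnp
    exact mem_biUnion.2 ⟨s, hsS, mem_biUnion.2 ⟨T', mem_filter.2 ⟨hT', hST'⟩, mem_biUnion.2
      ⟨x, hxT', mem_filter.2 ⟨hT, ne_of_mem_of_not_mem hsS hxS, hsT, hxT⟩⟩⟩⟩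
  have card_P : #P ≤ #S * (#S ^ 2 * (3 * 1)) := by
    refine card_biUnion_le_card_mul _ _ _ fun s _ => ?_
    refine (card_biUnion_le_card_mul _ _ (3 * 1) fun T' hT' => ?_).trans
      (Nat.mul_le_mul_right _ card_B)
    rw [← h.card_eq T' (mem_filter.1 hT').1]
    exact card_biUnion_le_card_mul _ _ _ fun x _ => h.card_pair_subset_le s x
  calc _ ≤ #(B ∪ P) := card_le_card cover
    _ ≤ #B + #P := card_union_le _ _
    _ ≤ #S ^ 2 + #S * (#S ^ 2 * (3 * 1)) := by gcongr
    _ ≤ #S ^ 3 + #S * (#S ^ 2 * (3 * 1)) := by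
        gcongr ?_ + _
        rcases (#S).eq_zero_or_pos with hS | hS
        · simp [hS]
        · exact Nat.pow_le_pow_right hS (by norm_num)
    _ = _ := by ring

theorem sum_not_disjoint (h : IsPartialTripleSystem 𝒯) (S : Finset α) (f : Finset α → ℝ) :
    ∑ T ∈ 𝒯 with ¬Disjoint S T, f T =
      ∑ T ∈ 𝒯 with T ⊆ S, f T + ∑ T ∈ 𝒯 with IsPendant 𝒯 S T, f T +
        ∑ T ∈ 𝒯 with (¬Disjoint S T ∧ ¬IsPendant 𝒯 S T) ∧ ¬T ⊆ S, f T := by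
  simp only [sum_filter, ← sum_add_distrib]
  refine sum_congr rfl fun T hT => ?_
  by_cases hpend : IsPendant 𝒯 S T
  · simp [hpend, hpend.not_disjoint, h.not_subset_of_card_inter_eq_one hT hpend.1]
  · by_cases hsub : T ⊆ S
    · have hmeet : ¬Disjoint S T := fun hdisj => by
        have := h.card_eq T hT
        simp [disjoint_self.1 (hdisj.mono_left hsub)] at this
      simp [hpend, hmeet, hsub]
    · simp [hpend, hsub]

end IsPartialTripleSystem

namespace IsRegularTripleSystem

theorem card_isPendant_le (h : IsRegularTripleSystem X 𝒯 D) (hS : S ⊆ X) :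
    #{T ∈ 𝒯 | IsPendant 𝒯 S T} ≤ #S * D := by
  rw [← sum_card_inter fun x hx => h.degree x (hS hx), card_filter]
  refine sum_le_sum fun T _ => ?_
  split_ifs with hpend
  · exact hpend.1.ge
  · exact Nat.zero_le _

theorem le_card_isPendant (h : IsRegularTripleSystem X 𝒯 D) (hS : S ⊆ X) :
    #S * D ≤ #{T ∈ 𝒯 | IsPendant 𝒯 S T} + 12 * #S ^ 3 := by
  have incidences : #S * D ≤ #{T ∈ 𝒯 | IsPendant 𝒯 S T} +
      3 * #{T ∈ 𝒯 | ¬Disjoint S T ∧ ¬IsPendant 𝒯 S T} := by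
    rw [← sum_card_inter fun x hx => h.degree x (hS hx), card_filter, card_filter, mul_sum,
      ← sum_add_distrib]
    refine sum_le_sum fun T hT => ?_
    by_cases hpend : IsPendant 𝒯 S T
    · simp [hpend, hpend.1]
    · by_cases hdisj : Disjoint S T
      · simp [hpend, disjoint_iff_inter_eq_empty.1 hdisj]
      · simpa [hpend, hdisj, h.card_eq T hT] using card_le_card (inter_subset_right : S ∩ T ⊆ T)
  have := h.card_not_isPendant_le S
  omega

end IsRegularTripleSystem

end TripleSystem

section LimitDensity

/-- The limiting probability, given that an element is initially present, that it survives `i`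
greedy steps; `y` is the duration of a step. With `t = i * y` this is the Euler scheme for
`f' = -d * exp (-t) * f ^ 3`, `f 0 = 1`, whose solution is
`(1 + 2 * d * (1 - exp (-t))) ^ (-1 / 2)`. -/
noncomputable def aliveDensity (d y : ℝ) : ℕ → ℝ
  | 0 => 1
  | i + 1 => aliveDensity d y i * (1 - d * y * ((1 - y) ^ i * aliveDensity d y i ^ 2))

/-- The limiting probability that after `i` greedy steps a given triple has not been drawn and its
two elements other than a given one are present, if they are so initially. -/
noncomputable def pendantDensity (d y : ℝ) (i : ℕ) : ℝ := (1 - y) ^ i * aliveDensity d y i ^ 2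

variable {d y : ℝ}

theorem aliveDensity_succ (d y : ℝ) (i : ℕ) :
    aliveDensity d y (i + 1) = aliveDensity d y i * (1 - d * y * pendantDensity d y i) := rfl

theorem pow_one_sub_mem_Icc (hy : y ∈ Set.Icc 0 1) (i : ℕ) : (1 - y) ^ i ∈ Set.Icc 0 1 :=
  have hy' := Set.Icc.mem_iff_one_sub_mem.1 hy
  ⟨pow_nonneg hy'.1 i, pow_le_one₀ hy'.1 hy'.2⟩

theorem pendantDensity_mem_Icc_of_aliveDensity_mem_Icc (hy : y ∈ Set.Icc 0 1) {i : ℕ}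
    (hf : aliveDensity d y i ∈ Set.Icc 0 1) : pendantDensity d y i ∈ Set.Icc 0 1 :=
  have hg := pow_one_sub_mem_Icc hy i
  ⟨mul_nonneg hg.1 (sq_nonneg _), mul_le_one₀ hg.2 (sq_nonneg _) (pow_le_one₀ hf.1 hf.2)⟩

theorem aliveDensity_mem_Icc (hy : y ∈ Set.Icc 0 1) (hdy : d * y ∈ Set.Icc 0 1) (i : ℕ) :
    aliveDensity d y i ∈ Set.Icc 0 1 := by
  induction i with
  | zero => simp [aliveDensity]
  | succ i ih =>
    have hq := pendantDensity_mem_Icc_of_aliveDensity_mem_Icc hy ih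
    exact unitInterval.mul_mem ih
      (Set.Icc.mem_iff_one_sub_mem.1 (unitInterval.mul_mem hdy hq))

theorem pendantDensity_mem_Icc (hy : y ∈ Set.Icc 0 1) (hdy : d * y ∈ Set.Icc 0 1) (i : ℕ) :
    pendantDensity d y i ∈ Set.Icc 0 1 :=
  pendantDensity_mem_Icc_of_aliveDensity_mem_Icc hy (aliveDensity_mem_Icc hy hdy i)

theorem aliveDensity_sq_mul_le_one (hy : y ∈ Set.Icc 0 1) (hdy : d * y ∈ Set.Icc 0 1) (i : ℕ) :
    aliveDensity d y i ^ 2 * (1 + 2 * d * (1 - (1 - y) ^ i)) ≤ 1 := by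
  induction i with
  | zero => simp [aliveDensity]
  | succ i ih =>
    have hx := unitInterval.mul_mem hdy (pendantDensity_mem_Icc hy hdy i)
    set x := d * y * pendantDensity d y i with hx_def
    rw [aliveDensity_succ, ← hx_def, pow_succ (1 - y) i]
    calc _ = (1 - x) ^ 2 *
          (aliveDensity d y i ^ 2 * (1 + 2 * d * (1 - (1 - y) ^ i)) + 2 * x) := by
          rw [hx_def, pendantDensity]; ring
      _ ≤ (1 - x) ^ 2 * (1 + 2 * x) := by gcongr
      _ = 1 - x ^ 2 * (1 + 2 * (1 - x)) := by ring
      _ ≤ 1 := sub_le_self _ (mul_nonneg (sq_nonneg x) (by linarith [hx.2]))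

theorem one_sub_three_mul_xi {d : ℝ} (hd : 0 ≤ d) : 1 - 3 * xi d = (√(1 + 2 * d))⁻¹ := by
  rw [xi, Real.rpow_neg (by linarith), ← Real.sqrt_eq_rpow, add_comm (2 * d)]
  ring

theorem aliveDensity_le (hd : 0 ≤ d) (hy : y ∈ Set.Icc 0 1) (hdy : d * y ∈ Set.Icc 0 1) (i : ℕ) :
    aliveDensity d y i ≤ 1 - 3 * xi d + d * (1 - y) ^ i := by
  set f := aliveDensity d y i
  set g := (1 - y) ^ i
  have hf := aliveDensity_mem_Icc hy hdy i
  have hg := pow_one_sub_mem_Icc hy i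
  have bound : f ^ 2 * (1 + 2 * d * (1 - g)) ≤ 1 := aliveDensity_sq_mul_le_one hy hdy i
  have hr : 0 < √(1 + 2 * d) := Real.sqrt_pos.2 (by linarith)
  have hr_sq : √(1 + 2 * d) ^ 2 = 1 + 2 * d := Real.sq_sqrt (by linarith)
  have hdg : 0 ≤ d * g := mul_nonneg hd hg.1
  have scaled : f * √(1 + 2 * d) ≤ 1 + d * g := by
    refine abs_le_of_sq_le_sq' ?_ (by linarith) |>.2
    have : f ^ 2 * (d * g) ≤ 1 * (d * g) := by
      gcongr
      exact pow_le_one₀ hf.1 hf.2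
    rw [mul_pow, hr_sq]
    nlinarith [sq_nonneg (d * g)]
  have one_le : 1 ≤ √(1 + 2 * d) := Real.one_le_sqrt.2 (by linarith)
  rw [one_sub_three_mul_xi hd]
  calc f ≤ (1 + d * g) / √(1 + 2 * d) := (le_div_iff₀ hr).2 scaled
    _ = (√(1 + 2 * d))⁻¹ + d * g / √(1 + 2 * d) := by rw [add_div, one_div]
    _ ≤ (√(1 + 2 * d))⁻¹ + d * g := by gcongr; exact div_le_self hdg one_le

end LimitDensity

section ProductApproximation

theorem exp_neg_le_one_sub_add_sq {s : ℝ} (hs : 0 ≤ s) : Real.exp (-s) ≤ 1 - s + s ^ 2 := by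
  rcases le_total s 1 with h | h
  · have := Real.abs_exp_sub_one_sub_id_le (x := -s) (by rwa [abs_neg, abs_of_nonneg hs])
    linarith [(abs_le.1 this).2]
  · have := Real.exp_le_one_iff.2 (neg_nonpos.2 hs)
    nlinarith

theorem one_sub_sum_le_prod_one_sub {ι : Type*} (s : Finset ι) {x : ι → ℝ}
    (hx : ∀ i ∈ s, x i ∈ Set.Icc 0 1) : 1 - ∑ i ∈ s, x i ≤ ∏ i ∈ s, (1 - x i) := by
  induction s using Finset.cons_induction with
  | empty => simp
  | cons a s ha ih =>
    rw [Finset.forall_mem_cons] at hx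
    have hsum := Finset.sum_nonneg fun i hi => (hx.2 i hi).1
    have := mul_le_mul_of_nonneg_left (ih hx.2) (sub_nonneg.2 hx.1.2)
    rw [Finset.sum_cons, Finset.prod_cons]
    nlinarith [mul_nonneg hx.1.1 hsum]

theorem abs_prod_one_sub_sub_le {ι : Type*} (s : Finset ι) {x : ι → ℝ}
    (hx : ∀ i ∈ s, x i ∈ Set.Icc 0 1) :
    |∏ i ∈ s, (1 - x i) - (1 - ∑ i ∈ s, x i)| ≤ (∑ i ∈ s, x i) ^ 2 := by
  have lower : 1 - ∑ i ∈ s, x i ≤ ∏ i ∈ s, (1 - x i) :=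
    one_sub_sum_le_prod_one_sub s hx
  have upper : ∏ i ∈ s, (1 - x i) ≤ 1 - ∑ i ∈ s, x i + (∑ i ∈ s, x i) ^ 2 :=
    calc ∏ i ∈ s, (1 - x i) ≤ ∏ i ∈ s, Real.exp (-x i) :=
          Finset.prod_le_prod (fun i hi => sub_nonneg.2 (hx i hi).2)
            fun i _ => Real.one_sub_le_exp_neg (x i)
      _ = Real.exp (-∑ i ∈ s, x i) := by rw [← Real.exp_sum, Finset.sum_neg_distrib]
      _ ≤ _ := exp_neg_le_one_sub_add_sq (Finset.sum_nonneg fun i hi => (hx i hi).1)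
  rw [abs_of_nonneg (sub_nonneg.2 lower)]
  linarith

theorem abs_pow_mul_pow_sub_le {x y : ℝ} (hx : x ∈ Set.Icc 0 1) (hy : y ∈ Set.Icc 0 1)
    (k t : ℕ) :
    |(1 - x) ^ k * (1 - y) ^ t - (1 - (k * x + t * y))| ≤ (k * x + t * y) ^ 2 := by
  have := abs_prod_one_sub_sub_le (Finset.univ : Finset (Fin k ⊕ Fin t))
    (x := Sum.elim (fun _ => x) (fun _ => y)) (by rintro (_ | _) _ <;> assumption)
  simpa using this

end ProductApproximation

section SurvivalComparison

open Finset

variable {α : Type*}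

theorem inv_card_mem_Icc (𝒯 : Finset α) : (#𝒯 : ℝ)⁻¹ ∈ Set.Icc 0 1 :=
  ⟨by positivity, Nat.cast_inv_le_one _⟩

theorem mul_inv_card_mem_Icc {𝒯 : Finset α} {d : ℝ} (hd : 0 ≤ d) (hdN : d ≤ #𝒯) :
    d * (#𝒯 : ℝ)⁻¹ ∈ Set.Icc 0 1 :=
  ⟨by positivity, div_le_one_of_le₀ hdN (by positivity)⟩

variable [DecidableEq α]

/-- The conditional probability that `S` survives `i` greedy steps, given that all of `S` is present
initially. -/
noncomputable def condSurvival (p : ℝ) (X : Finset α) (𝒯 : Finset (Finset α)) (i : ℕ)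
    (S : Finset α) : ℝ :=
  survival p X 𝒯 i S / p ^ #S

/-- The limiting value of `condSurvival`: the elements of `S` survive independently of each other
and of the event that no triple inside `S` is drawn. -/
noncomputable def limitSurvival (d : ℝ) (𝒯 : Finset (Finset α)) (i : ℕ) (S : Finset α) : ℝ :=
  aliveDensity d (#𝒯 : ℝ)⁻¹ i ^ #S * ((1 - (#𝒯 : ℝ)⁻¹) ^ i) ^ triplesInside 𝒯 S

/-- The deviation of `condSurvival` from its limiting value. -/
noncomputable def survivalError (p d : ℝ) (X : Finset α) (𝒯 : Finset (Finset α)) (i : ℕ)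
    (S : Finset α) : ℝ :=
  |condSurvival p X 𝒯 i S - limitSurvival d 𝒯 i S|

/-- The rate, per element of a set of size `k`, at which `survivalError` grows because the recursion
for `condSurvival` is only approximately that for `limitSurvival`; `y` is the duration of a step. -/
noncomputable def stepError (p d y : ℝ) (k : ℕ) : ℝ :=
  16 * (k : ℝ) ^ 2 * p + k * (d + k) ^ 2 * y

theorem stepError_mono {p d y : ℝ} (hp : 0 ≤ p) (hd : 0 ≤ d) (hy : 0 ≤ y) :
    Monotone (stepError p d y) := fun k l h => by
  unfold stepError
  gcongr

variable {X S T : Finset α} {𝒯 : Finset (Finset α)} {D : ℕ} {p d : ℝ}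

theorem condSurvival_mem_Icc (hp₀ : 0 ≤ p) (hp₁ : p ≤ 1) (h𝒯 : 𝒯.Nonempty) (i : ℕ)
    (hS : S ⊆ X) : condSurvival p X 𝒯 i S ∈ Set.Icc 0 1 :=
  ⟨div_nonneg (survival_nonneg hp₀ hp₁ i S) (by positivity),
    div_le_one_of_le₀ (survival_le hp₀ hp₁ h𝒯 i hS) (by positivity)⟩

theorem limitSurvival_mem_Icc (hd : 0 ≤ d) (hdN : d ≤ #𝒯) (i : ℕ) (S : Finset α) :
    limitSurvival d 𝒯 i S ∈ Set.Icc 0 1 :=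
  have hf := aliveDensity_mem_Icc (inv_card_mem_Icc 𝒯) (mul_inv_card_mem_Icc hd hdN) i
  have hg := pow_one_sub_mem_Icc (inv_card_mem_Icc 𝒯) i
  ⟨mul_nonneg (pow_nonneg hf.1 _) (pow_nonneg hg.1 _),
    mul_le_one₀ (pow_le_one₀ hf.1 hf.2) (pow_nonneg hg.1 _) (pow_le_one₀ hg.1 hg.2)⟩

theorem survivalError_le_one (hp₀ : 0 ≤ p) (hp₁ : p ≤ 1) (hd : 0 ≤ d) (hdN : d ≤ #𝒯)
    (h𝒯 : 𝒯.Nonempty) (i : ℕ) (hS : S ⊆ X) : survivalError p d X 𝒯 i S ≤ 1 :=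
  have ha := condSurvival_mem_Icc hp₀ hp₁ h𝒯 i hS
  have hφ := limitSurvival_mem_Icc hd hdN i S
  abs_sub_le_of_nonneg_of_le ha.1 ha.2 hφ.1 hφ.2

theorem survivalError_zero (hp : p ≠ 0) (hS : S ⊆ X) : survivalError p d X 𝒯 0 S = 0 := by
  simp [survivalError, condSurvival, limitSurvival, survival_zero hS, aliveDensity, hp]

theorem limitSurvival_succ (i : ℕ) (S : Finset α) :
    limitSurvival d 𝒯 (i + 1) S = limitSurvival d 𝒯 i S *
      ((1 - d * (#𝒯 : ℝ)⁻¹ * pendantDensity d (#𝒯 : ℝ)⁻¹ i) ^ #S *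
        (1 - (#𝒯 : ℝ)⁻¹) ^ triplesInside 𝒯 S) := by
  simp only [limitSurvival, aliveDensity_succ, mul_pow, pow_succ (1 - (#𝒯 : ℝ)⁻¹) i]
  ring

theorem triplesInside_mul_inv_card_le_one (𝒯 : Finset (Finset α)) (S : Finset α) :
    triplesInside 𝒯 S * (#𝒯 : ℝ)⁻¹ ≤ 1 :=
  div_le_one_of_le₀ (by exact_mod_cast card_filter_le _ _) (by positivity)

namespace IsPartialTripleSystem

theorem limitSurvival_union (h : IsPartialTripleSystem 𝒯) (hT : T ∈ 𝒯) (hST : IsPendant 𝒯 S T)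
    (i : ℕ) :
    limitSurvival d 𝒯 i (S ∪ T) = limitSurvival d 𝒯 i S * pendantDensity d (#𝒯 : ℝ)⁻¹ i := by
  rw [limitSurvival, h.card_union_of_isPendant hT hST, hST.2, limitSurvival, pendantDensity]
  ring

theorem abs_limitSurvival_succ_sub_le (h : IsPartialTripleSystem 𝒯) (hd : 0 ≤ d) (hdN : d ≤ #𝒯)
    (i : ℕ) (S : Finset α) :
    |limitSurvival d 𝒯 (i + 1) S -
      (limitSurvival d 𝒯 i S - (#𝒯 : ℝ)⁻¹ * (triplesInside 𝒯 S * limitSurvival d 𝒯 i S +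
        d * #S * (limitSurvival d 𝒯 i S * pendantDensity d (#𝒯 : ℝ)⁻¹ i)))| ≤
      (#𝒯 : ℝ)⁻¹ * ((d * #S + (#S : ℝ) ^ 2) ^ 2 * (#𝒯 : ℝ)⁻¹) := by
  have hy := inv_card_mem_Icc 𝒯
  have hdy := mul_inv_card_mem_Icc hd hdN
  have hφ := limitSurvival_mem_Icc hd hdN i S
  have hq := pendantDensity_mem_Icc hy hdy i
  have ht : (triplesInside 𝒯 S : ℝ) ≤ (#S : ℝ) ^ 2 := by exact_mod_cast h.triplesInside_le_sq S
  rw [limitSurvival_succ]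
  set y := (#𝒯 : ℝ)⁻¹
  set φ := limitSurvival d 𝒯 i S
  set q := pendantDensity d y i
  set t := triplesInside 𝒯 S
  have rate_nonneg : 0 ≤ #S * (d * y * q) + t * y :=
    add_nonneg (mul_nonneg (by positivity) (mul_nonneg hdy.1 hq.1))
      (mul_nonneg (by positivity) hy.1)
  have rate_le : #S * (d * y * q) + t * y ≤ (d * #S + (#S : ℝ) ^ 2) * y :=
    calc _ ≤ #S * (d * y) + (#S : ℝ) ^ 2 * y := by
          have := mul_le_of_le_one_right hdy.1 hq.2
          have := hy.1
          gcongr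
      _ = _ := by ring
  calc _ = |φ * ((1 - d * y * q) ^ #S * (1 - y) ^ t - (1 - (#S * (d * y * q) + t * y)))| := by
        congr 1; ring
    _ = φ * |(1 - d * y * q) ^ #S * (1 - y) ^ t - (1 - (#S * (d * y * q) + t * y))| := by
        rw [abs_mul, abs_of_nonneg hφ.1]
    _ ≤ 1 * (#S * (d * y * q) + t * y) ^ 2 :=
        mul_le_mul hφ.2 (abs_pow_mul_pow_sub_le (unitInterval.mul_mem hdy hq) hy _ _)
          (abs_nonneg _) zero_le_one
    _ ≤ 1 * ((d * #S + (#S : ℝ) ^ 2) * y) ^ 2 := by gcongr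
    _ = _ := by ring

end IsPartialTripleSystem

namespace IsRegularTripleSystem

theorem survival_union_div_le (h : IsRegularTripleSystem X 𝒯 D) (hp₀ : 0 < p) (hp₁ : p ≤ 1)
    (i : ℕ) (hS : S ⊆ X) (hT : T ∈ 𝒯) (hTS : ¬T ⊆ S) :
    survival p X 𝒯 i (S ∪ T) / p ^ #S ≤ p := by
  have card_lt : #S + 1 ≤ #(S ∪ T) := card_lt_card (Finset.ssubset_iff_subset_ne.2
    ⟨subset_union_left, fun e => hTS (e ▸ subset_union_right)⟩)
  rw [div_le_iff₀ (by positivity), ← pow_succ']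
  exact (survival_le hp₀.le hp₁ ⟨T, hT⟩ i (union_subset hS (h.subset T hT))).trans
    (pow_le_pow_of_le_one hp₀.le hp₁ card_lt)

theorem condSurvival_succ (h : IsRegularTripleSystem X 𝒯 D) (h𝒯 : 𝒯.Nonempty) (hp₀ : p ≠ 0)
    (i : ℕ) (S : Finset α) :
    condSurvival p X 𝒯 (i + 1) S = condSurvival p X 𝒯 i S - (#𝒯 : ℝ)⁻¹ *
      (triplesInside 𝒯 S * condSurvival p X 𝒯 i S +
        p ^ 2 * ∑ T ∈ 𝒯 with IsPendant 𝒯 S T, condSurvival p X 𝒯 i (S ∪ T) +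
        ∑ T ∈ 𝒯 with (¬Disjoint S T ∧ ¬IsPendant 𝒯 S T) ∧ ¬T ⊆ S,
          survival p X 𝒯 i (S ∪ T) / p ^ #S) := by
  have inside : ∑ T ∈ 𝒯 with T ⊆ S, survival p X 𝒯 i (S ∪ T) =
      triplesInside 𝒯 S * survival p X 𝒯 i S := by
    rw [sum_congr rfl fun T hT => by rw [union_eq_left.2 (mem_filter.1 hT).2], sum_const,
      nsmul_eq_mul, triplesInside]
  have pendant : p ^ 2 * ∑ T ∈ 𝒯 with IsPendant 𝒯 S T, condSurvival p X 𝒯 i (S ∪ T) =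
      (∑ T ∈ 𝒯 with IsPendant 𝒯 S T, survival p X 𝒯 i (S ∪ T)) / p ^ #S := by
    rw [mul_sum, sum_div]
    refine sum_congr rfl fun T hT => ?_
    obtain ⟨hT, hST⟩ := mem_filter.1 hT
    rw [condSurvival, h.card_union_of_isPendant hT hST]
    field_simp
    ring
  rw [pendant, condSurvival, survival_succ h𝒯, h.sum_not_disjoint, inside, condSurvival, ← sum_div]
  ring

theorem abs_condSurvival_succ_sub_le (h : IsRegularTripleSystem X 𝒯 D) (h𝒯 : 𝒯.Nonempty)
    (hp₀ : 0 < p) (hp₁ : p ≤ 1) (i : ℕ) (hS : S ⊆ X) :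
    |condSurvival p X 𝒯 (i + 1) S -
      (condSurvival p X 𝒯 i S - (#𝒯 : ℝ)⁻¹ * (triplesInside 𝒯 S * condSurvival p X 𝒯 i S +
        p ^ 2 * ∑ T ∈ 𝒯 with IsPendant 𝒯 S T, condSurvival p X 𝒯 i (S ∪ T)))| ≤
      (#𝒯 : ℝ)⁻¹ * (4 * (#S : ℝ) ^ 3 * p) := by
  set R := 𝒯.filter fun T => (¬Disjoint S T ∧ ¬IsPendant 𝒯 S T) ∧ ¬T ⊆ S with hR
  have card_R : (#R : ℝ) ≤ 4 * (#S : ℝ) ^ 3 := by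
    have : R ⊆ {T ∈ 𝒯 | ¬Disjoint S T ∧ ¬IsPendant 𝒯 S T} :=
      monotone_filter_right 𝒯 fun T _ hT => hT.1
    exact_mod_cast (card_le_card this).trans (h.card_not_isPendant_le S)
  have stray_nonneg : 0 ≤ ∑ T ∈ R, survival p X 𝒯 i (S ∪ T) / p ^ #S :=
    sum_nonneg fun T _ => div_nonneg (survival_nonneg hp₀.le hp₁ i _) (by positivity)
  have stray_le : ∑ T ∈ R, survival p X 𝒯 i (S ∪ T) / p ^ #S ≤ 4 * (#S : ℝ) ^ 3 * p :=
    calc _ ≤ #R • p := sum_le_card_nsmul _ _ _ fun T hT => by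
          obtain ⟨hT, -, hTS⟩ := mem_filter.1 hT
          exact h.survival_union_div_le hp₀ hp₁ i hS hT hTS
      _ ≤ _ := by rw [nsmul_eq_mul]; gcongr
  rw [h.condSurvival_succ h𝒯 hp₀.ne', ← hR]
  calc _ = |-((#𝒯 : ℝ)⁻¹ * ∑ T ∈ R, survival p X 𝒯 i (S ∪ T) / p ^ #S)| := by congr 1; ring
    _ = (#𝒯 : ℝ)⁻¹ * ∑ T ∈ R, survival p X 𝒯 i (S ∪ T) / p ^ #S := by
        rw [abs_neg, abs_of_nonneg (by positivity)]
    _ ≤ _ := by gcongr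

theorem abs_sq_mul_card_isPendant_sub_le (h : IsRegularTripleSystem X 𝒯 D) (hp₀ : 0 ≤ p)
    (hp₁ : p ≤ 1) (hS : S ⊆ X) :
    |p ^ 2 * #{T ∈ 𝒯 | IsPendant 𝒯 S T} - D * p ^ 2 * #S| ≤ 12 * (#S : ℝ) ^ 3 * p := by
  have upper : (#{T ∈ 𝒯 | IsPendant 𝒯 S T} : ℝ) ≤ #S * D := by exact_mod_cast h.card_isPendant_le hS
  have lower : (#S * D : ℝ) ≤ #{T ∈ 𝒯 | IsPendant 𝒯 S T} + 12 * (#S : ℝ) ^ 3 := by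
    exact_mod_cast h.le_card_isPendant hS
  calc _ = p ^ 2 * (#S * D - #{T ∈ 𝒯 | IsPendant 𝒯 S T}) := by
        rw [abs_sub_comm, abs_of_nonneg] <;> nlinarith [sq_nonneg p]
    _ ≤ p * (12 * (#S : ℝ) ^ 3) := by
        gcongr
        exacts [pow_le_of_le_one hp₀ hp₁ two_ne_zero, by linarith]
    _ = _ := by ring

theorem abs_pendant_sum_sub_le (h : IsRegularTripleSystem X 𝒯 D) (hp₀ : 0 ≤ p) (hp₁ : p ≤ 1)
    (hd : d = D * p ^ 2) (hdN : d ≤ #𝒯) (i : ℕ) (hS : S ⊆ X) {δ : ℝ} (hδ : 0 ≤ δ)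
    (hpend : ∀ T ∈ 𝒯, IsPendant 𝒯 S T → survivalError p d X 𝒯 i (S ∪ T) ≤ δ) :
    |p ^ 2 * ∑ T ∈ 𝒯 with IsPendant 𝒯 S T, condSurvival p X 𝒯 i (S ∪ T) -
      d * #S * (limitSurvival d 𝒯 i S * pendantDensity d (#𝒯 : ℝ)⁻¹ i)| ≤
      d * #S * δ + 12 * (#S : ℝ) ^ 3 * p := by
  have hd₀ : 0 ≤ d := by rw [hd]; positivity
  set ψ := limitSurvival d 𝒯 i S * pendantDensity d (#𝒯 : ℝ)⁻¹ i with hψ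
  have ψ_mem : ψ ∈ Set.Icc 0 1 := unitInterval.mul_mem (limitSurvival_mem_Icc hd₀ hdN i S)
    (pendantDensity_mem_Icc (inv_card_mem_Icc 𝒯) (mul_inv_card_mem_Icc hd₀ hdN) i)
  set P := 𝒯.filter (IsPendant 𝒯 S)
  have card_P : (#P : ℝ) ≤ #S * D := by exact_mod_cast h.card_isPendant_le hS
  have sum_close : |∑ T ∈ P, (condSurvival p X 𝒯 i (S ∪ T) - ψ)| ≤ #S * D * δ :=
    calc _ ≤ ∑ T ∈ P, |condSurvival p X 𝒯 i (S ∪ T) - ψ| := abs_sum_le_sum_abs _ _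
      _ ≤ #P • δ := sum_le_card_nsmul _ _ _ fun T hT => by
          obtain ⟨hT, hST⟩ := mem_filter.1 hT
          rw [hψ, ← h.limitSurvival_union hT hST]
          exact hpend T hT hST
      _ ≤ #S * D * δ := by rw [nsmul_eq_mul]; gcongr
  calc _ = |p ^ 2 * ∑ T ∈ P, (condSurvival p X 𝒯 i (S ∪ T) - ψ) +
          (p ^ 2 * #P - D * p ^ 2 * #S) * ψ| := by
        rw [sum_sub_distrib, sum_const, nsmul_eq_mul, hd]
        congr 1; ring
    _ ≤ p ^ 2 * |∑ T ∈ P, (condSurvival p X 𝒯 i (S ∪ T) - ψ)| +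
          |p ^ 2 * #P - D * p ^ 2 * #S| * ψ := by
        refine (abs_add_le _ _).trans_eq ?_
        rw [abs_mul, abs_mul, abs_of_nonneg (sq_nonneg p), abs_of_nonneg ψ_mem.1]
    _ ≤ p ^ 2 * (#S * D * δ) + 12 * (#S : ℝ) ^ 3 * p * 1 := by
        gcongr
        exacts [ψ_mem.1, h.abs_sq_mul_card_isPendant_sub_le hp₀ hp₁ hS, ψ_mem.2]
    _ = _ := by rw [hd]; ring

theorem survivalError_succ_le (h : IsRegularTripleSystem X 𝒯 D) (h𝒯 : 𝒯.Nonempty) (hp₀ : 0 < p)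
    (hp₁ : p ≤ 1) (hd : d = D * p ^ 2) (hdN : d ≤ #𝒯) (i : ℕ) (hS : S ⊆ X) {δ : ℝ} (hδ : 0 ≤ δ)
    (hpend : ∀ T ∈ 𝒯, IsPendant 𝒯 S T → survivalError p d X 𝒯 i (S ∪ T) ≤ δ) :
    survivalError p d X 𝒯 (i + 1) S ≤ survivalError p d X 𝒯 i S +
      (#𝒯 : ℝ)⁻¹ * (#S * (d * δ + stepError p d (#𝒯 : ℝ)⁻¹ #S)) := by
  have hd₀ : 0 ≤ d := by rw [hd]; positivity
  have ht := triplesInside_mul_inv_card_le_one 𝒯 S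
  have survival_close := h.abs_condSurvival_succ_sub_le h𝒯 hp₀ hp₁ i hS
  have limit_close := h.abs_limitSurvival_succ_sub_le hd₀ hdN i S
  have pendant_close := h.abs_pendant_sum_sub_le hp₀.le hp₁ hd hdN i hS hδ hpend
  unfold survivalError stepError
  set y := (#𝒯 : ℝ)⁻¹
  have hy : 0 ≤ y := (inv_card_mem_Icc 𝒯).1
  set a := condSurvival p X 𝒯 i S
  set a' := condSurvival p X 𝒯 (i + 1) S
  set φ := limitSurvival d 𝒯 i S
  set φ' := limitSurvival d 𝒯 (i + 1) S
  set t := (triplesInside 𝒯 S : ℝ)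
  set P := p ^ 2 * ∑ T ∈ 𝒯 with IsPendant 𝒯 S T, condSurvival p X 𝒯 i (S ∪ T)
  set Q := d * #S * (φ * pendantDensity d y i)
  have contraction : |(1 - t * y) * (a - φ)| ≤ |a - φ| := by
    rw [abs_mul, abs_of_nonneg (sub_nonneg.2 ht)]
    exact mul_le_of_le_one_left (abs_nonneg _) (sub_le_self _ (by positivity))
  calc |a' - φ'| = |(1 - t * y) * (a - φ) - y * (P - Q) + (a' - (a - y * (t * a + P))) -
          (φ' - (φ - y * (t * φ + Q)))| := by congr 1; ring
    _ ≤ |(1 - t * y) * (a - φ)| + |y * (P - Q)| + |a' - (a - y * (t * a + P))| +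
          |φ' - (φ - y * (t * φ + Q))| := by
        grw [abs_sub, abs_add_le, abs_sub]
    _ ≤ |a - φ| + y * (d * #S * δ + 12 * (#S : ℝ) ^ 3 * p) + y * (4 * (#S : ℝ) ^ 3 * p) +
          y * ((d * #S + (#S : ℝ) ^ 2) ^ 2 * y) := by
        rw [abs_mul y, abs_of_nonneg hy]
        gcongr
    _ = _ := by ring

end IsRegularTripleSystem

end SurvivalComparison

section TimeBlocks

open Finset

/-- The powers `r ^ k` are a supersolution, growing at the rate `27 * d + 1` in `r`, of the
recursion in which an error at `k` is fed by the error at `k + 2`. -/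
theorem pow_add_mul_pow_add_two_le {r y d : ℝ} (hr : r ∈ Set.Icc 1 3) (hy : 0 ≤ y) (hd : 0 ≤ d)
    (k : ℕ) : r ^ k + y * (k * (d * r ^ (k + 2) + 1)) ≤ (r + (27 * d + 1) * y) ^ k := by
  rcases k with _ | k
  · simp
  have r_nonneg : 0 ≤ r := zero_le_one.trans hr.1
  have cube_le : r ^ 3 ≤ 3 ^ 3 := pow_le_pow_left₀ r_nonneg hr.2 3
  have one_le : 1 ≤ r ^ k := one_le_pow₀ hr.1
  calc _ = r ^ (k + 1) + y * ((k + 1 : ℕ) * (d * (r ^ 3 * r ^ k) + 1)) := by ring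
    _ ≤ r ^ (k + 1) + y * ((k + 1 : ℕ) * (d * (3 ^ 3 * r ^ k) + r ^ k)) := by gcongr
    _ = r ^ (k + 1) + (k + 1 : ℕ) * r ^ (k + 1 - 1) * ((27 * d + 1) * y) := by
        rw [Nat.add_sub_cancel]; ring
    _ ≤ _ := pow_add_mul_le_add_pow r_nonneg (by positivity) _

theorem one_le_half_pow_mul_pow {r : ℝ} (hr : 2 ≤ r) {K k : ℕ} (hK : K ≤ k) :
    1 ≤ (1 / 2) ^ K * r ^ k :=
  calc (1 : ℝ) = (1 / 2) ^ K * 2 ^ K := by rw [← mul_pow]; norm_num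
    _ ≤ (1 / 2) ^ K * 2 ^ k := by gcongr; norm_num
    _ ≤ (1 / 2) ^ K * r ^ k := by gcongr

variable {α : Type*} [DecidableEq α] {X S : Finset α} {𝒯 : Finset (Finset α)} {D : ℕ} {p d : ℝ}

namespace IsPartialTripleSystem

theorem triplesInside_singleton (h : IsPartialTripleSystem 𝒯) (x : α) :
    triplesInside 𝒯 {x} = 0 := by
  refine card_eq_zero.2 (filter_eq_empty_iff.2 fun T hT hTx => ?_)
  simpa [h.card_eq T hT] using card_le_card hTx

end IsPartialTripleSystem

namespace IsRegularTripleSystem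

theorem survivalError_succ_le_half_pow_mul_pow (h : IsRegularTripleSystem X 𝒯 D)
    (h𝒯 : 𝒯.Nonempty) (hp₀ : 0 < p) (hp₁ : p ≤ 1) (hd : d = D * p ^ 2) (hdN : d ≤ #𝒯) {K i : ℕ}
    {r : ℝ} (hr : r ∈ Set.Icc 1 3) (hE : stepError p d (#𝒯 : ℝ)⁻¹ K ≤ (1 / 2) ^ K)
    (hi : ∀ S ⊆ X, survivalError p d X 𝒯 i S ≤ (1 / 2) ^ K * r ^ #S) (hS : S ⊆ X)
    (hK : #S ≤ K) :
    survivalError p d X 𝒯 (i + 1) S ≤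
      (1 / 2) ^ K * (r + (27 * d + 1) * (#𝒯 : ℝ)⁻¹) ^ #S := by
  have hd₀ : 0 ≤ d := by rw [hd]; positivity
  have r_nonneg : 0 ≤ r := zero_le_one.trans hr.1
  set y := (#𝒯 : ℝ)⁻¹
  have hy : 0 ≤ y := (inv_card_mem_Icc 𝒯).1
  have pendant_error : ∀ T ∈ 𝒯, IsPendant 𝒯 S T →
      survivalError p d X 𝒯 i (S ∪ T) ≤ (1 / 2) ^ K * r ^ (#S + 2) := fun T hT hST => by
    rw [← h.card_union_of_isPendant hT hST]
    exact hi _ (union_subset hS (h.subset T hT))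
  calc survivalError p d X 𝒯 (i + 1) S
      ≤ survivalError p d X 𝒯 i S +
          y * (#S * (d * ((1 / 2) ^ K * r ^ (#S + 2)) + stepError p d y #S)) :=
        h.survivalError_succ_le h𝒯 hp₀ hp₁ hd hdN _ hS (by positivity) pendant_error
    _ ≤ (1 / 2) ^ K * r ^ #S +
          y * (#S * (d * ((1 / 2) ^ K * r ^ (#S + 2)) + (1 / 2) ^ K)) := by
        gcongr
        exacts [hi S hS, (stepError_mono hp₀.le hd₀ hy hK).trans hE]
    _ = (1 / 2) ^ K * (r ^ #S + y * (#S * (d * r ^ (#S + 2) + 1))) := by ring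
    _ ≤ (1 / 2) ^ K * (r + (27 * d + 1) * y) ^ #S := by
        gcongr
        exact pow_add_mul_pow_add_two_le hr hy hd₀ _

theorem survivalError_add_le (h : IsRegularTripleSystem X 𝒯 D) (h𝒯 : 𝒯.Nonempty) (hp₀ : 0 < p)
    (hp₁ : p ≤ 1) (hd : d = D * p ^ 2) (hdN : d ≤ #𝒯) {K i₀ : ℕ}
    (hE : stepError p d (#𝒯 : ℝ)⁻¹ K ≤ (1 / 2) ^ K)
    (h₀ : ∀ S ⊆ X, #S < K → survivalError p d X 𝒯 i₀ S ≤ (1 / 2) ^ K) (l : ℕ)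
    (hl : (27 * d + 1) * l ≤ #𝒯) (hS : S ⊆ X) :
    survivalError p d X 𝒯 (i₀ + l) S ≤
      (1 / 2) ^ K * (2 + (27 * d + 1) * (#𝒯 : ℝ)⁻¹ * l) ^ #S := by
  have hd₀ : 0 ≤ d := by rw [hd]; positivity
  have large (l : ℕ) {S : Finset α} (hS : S ⊆ X) (hK : K ≤ #S) :
      survivalError p d X 𝒯 (i₀ + l) S ≤
        (1 / 2) ^ K * (2 + (27 * d + 1) * (#𝒯 : ℝ)⁻¹ * l) ^ #S :=
    (survivalError_le_one hp₀.le hp₁ hd₀ hdN h𝒯 _ hS).trans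
      (one_le_half_pow_mul_pow (le_add_of_nonneg_right (by positivity)) hK)
  induction l generalizing S with
  | zero =>
    rcases le_or_gt K #S with hK | hK
    · exact large 0 hS hK
    · exact (h₀ S hS hK).trans (le_mul_of_one_le_right (by positivity) (one_le_pow₀ (by simp)))
  | succ l ih =>
    rcases le_or_gt K #S with hK | hK
    · exact large (l + 1) hS hK
    have hl' : (27 * d + 1) * l ≤ #𝒯 := le_trans (by gcongr; simp) hl
    have rate_mem : 2 + (27 * d + 1) * (#𝒯 : ℝ)⁻¹ * l ∈ Set.Icc 1 3 := by
      have : (27 * d + 1) * l * (#𝒯 : ℝ)⁻¹ ≤ 1 := div_le_one_of_le₀ hl' (by positivity)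
      have : 0 ≤ (27 * d + 1) * (#𝒯 : ℝ)⁻¹ * l := by positivity
      constructor <;> linarith
    refine (h.survivalError_succ_le_half_pow_mul_pow h𝒯 hp₀ hp₁ hd hdN rate_mem hE
      (fun _ => ih hl') hS hK.le).trans_eq ?_
    push_cast
    ring

theorem survivalError_le_half_pow (h : IsRegularTripleSystem X 𝒯 D) (h𝒯 : 𝒯.Nonempty)
    (hp₀ : 0 < p) (hp₁ : p ≤ 1) (hd : d = D * p ^ 2) (hdN : d ≤ #𝒯) {L : ℕ}
    (hL : (27 * d + 1) * L ≤ #𝒯) (j K : ℕ)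
    (hE : stepError p d (#𝒯 : ℝ)⁻¹ (3 ^ j * K) ≤ (1 / 2) ^ (3 ^ j * K)) {i : ℕ} (hi : i ≤ j * L)
    (hS : S ⊆ X) (hK : #S < K) : survivalError p d X 𝒯 i S ≤ (1 / 2) ^ K := by
  have hd₀ : 0 ≤ d := by rw [hd]; positivity
  induction j generalizing K i S with
  | zero =>
    obtain rfl : i = 0 := by simpa using hi
    rw [survivalError_zero hp₀.ne' hS]
    positivity
  | succ j ih =>
    rw [pow_succ, mul_assoc] at hE
    have half_pow_le {k l : ℕ} (hkl : k ≤ l) : (1 / 2 : ℝ) ^ l ≤ (1 / 2) ^ k :=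
      pow_le_pow_of_le_one (by norm_num) (by norm_num) hkl
    obtain hij | ⟨l, rfl⟩ := (le_total i (j * L)).imp_right Nat.exists_eq_add_of_le
    · exact (ih (3 * K) hE hij hS (by omega)).trans (half_pow_le (by omega))
    have hl : (27 * d + 1) * l ≤ #𝒯 := by
      refine le_trans ?_ hL
      gcongr
      rw [Nat.succ_mul] at hi
      omega
    have hK_le : 3 * K ≤ 3 ^ j * (3 * K) := Nat.le_mul_of_pos_left _ (by positivity)
    have hE' : stepError p d (#𝒯 : ℝ)⁻¹ (3 * K) ≤ (1 / 2) ^ (3 * K) :=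
      (stepError_mono hp₀.le hd₀ (inv_card_mem_Icc 𝒯).1 hK_le).trans (hE.trans (half_pow_le hK_le))
    have base_le : 2 + (27 * d + 1) * (#𝒯 : ℝ)⁻¹ * l ≤ 4 := by
      have : (27 * d + 1) * l * (#𝒯 : ℝ)⁻¹ ≤ 1 := div_le_one_of_le₀ hl (by positivity)
      linarith
    calc survivalError p d X 𝒯 (j * L + l) S
        ≤ (1 / 2) ^ (3 * K) * (2 + (27 * d + 1) * (#𝒯 : ℝ)⁻¹ * l) ^ #S :=
          h.survivalError_add_le h𝒯 hp₀ hp₁ hd hdN hE'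
            (fun S hS hSK => ih (3 * K) hE le_rfl hS hSK) l hl hS
      _ ≤ (1 / 2) ^ (3 * K) * 4 ^ K := by
          gcongr ?_ * ?_
          exact (pow_le_pow_left₀ (by positivity) base_le _).trans
            (pow_le_pow_right₀ (by norm_num) hK.le)
      _ = (1 / 2) ^ K := by rw [pow_mul, ← mul_pow]; norm_num

theorem survivalError_mul_card_le_half_pow (h : IsRegularTripleSystem X 𝒯 D) (h𝒯 : 𝒯.Nonempty)
    (hp₀ : 0 < p) (hp₁ : p ≤ 1) (hd : d = D * p ^ 2) {q : ℕ} (hdq : 27 * d + 1 ≤ q)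
    (hqN : q ≤ #𝒯) (t K : ℕ)
    (hE : stepError p d (#𝒯 : ℝ)⁻¹ (3 ^ (2 * q * t) * K) ≤ (1 / 2) ^ (3 ^ (2 * q * t) * K))
    (hS : S ⊆ X) (hK : #S < K) : survivalError p d X 𝒯 (t * #𝒯) S ≤ (1 / 2) ^ K := by
  have hd₀ : 0 ≤ d := by rw [hd]; positivity
  have hqN' : (q : ℝ) ≤ #𝒯 := by exact_mod_cast hqN
  have hq : 0 < q := by exact_mod_cast (show (0 : ℝ) < q by linarith)
  have block_fits : (27 * d + 1) * (#𝒯 / q : ℕ) ≤ #𝒯 :=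
    calc _ ≤ (q * (#𝒯 / q : ℕ) : ℝ) := by gcongr
      _ ≤ #𝒯 := by exact_mod_cast Nat.mul_div_le _ _
  have blocks_cover : t * #𝒯 ≤ 2 * q * t * (#𝒯 / q) := by
    have := Nat.lt_mul_div_succ #𝒯 hq
    have : q ≤ q * (#𝒯 / q) := Nat.le_mul_of_pos_right _ (Nat.div_pos hqN hq)
    calc t * #𝒯 ≤ t * (2 * (q * (#𝒯 / q))) := by gcongr; linarith
      _ = _ := by ring
  exact h.survivalError_le_half_pow h𝒯 hp₀ hp₁ hd (by linarith) block_fits _ K hE blocks_cover hS hK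

theorem survival_singleton_le (h : IsRegularTripleSystem X 𝒯 D) (h𝒯 : 𝒯.Nonempty)
    (hp₀ : 0 < p) (hd : d = D * p ^ 2) (hdN : d ≤ #𝒯) (t : ℕ) {x : α} {ε : ℝ}
    (hε : survivalError p d X 𝒯 (t * #𝒯) {x} ≤ ε) :
    survival p X 𝒯 (t * #𝒯) {x} ≤ p * (1 - 3 * xi d + d * Real.exp (-t) + ε) := by
  have hd₀ : 0 ≤ d := by rw [hd]; positivity
  have hy := inv_card_mem_Icc 𝒯
  have decay : (1 - (#𝒯 : ℝ)⁻¹) ^ (t * #𝒯) ≤ Real.exp (-t) := by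
    have := pow_le_pow_left₀ (sub_nonneg.2 hy.2) (Real.one_sub_le_exp_neg (#𝒯 : ℝ)⁻¹) (t * #𝒯)
    rwa [← Real.exp_nat_mul, Nat.cast_mul, mul_neg, mul_assoc,
      mul_inv_cancel₀ (by simpa using h𝒯.ne_empty), mul_one] at this
  have alive := aliveDensity_le hd₀ hy (mul_inv_card_mem_Icc hd₀ hdN) (t * #𝒯)
  have decay_mul := mul_le_mul_of_nonneg_left decay hd₀
  rw [survivalError, limitSurvival, h.triplesInside_singleton, condSurvival] at hε
  simp only [card_singleton, pow_one, pow_zero, mul_one] at hε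
  rw [← div_le_iff₀' hp₀]
  linarith [(abs_le.1 hε).2]

theorem le_three_mul_bernoulliMean_packingNumber (h : IsRegularTripleSystem X 𝒯 D)
    (h𝒯 : 𝒯.Nonempty) (hp₀ : 0 < p) (hp₁ : p ≤ 1) (hd : d = D * p ^ 2) (hdN : d ≤ #𝒯) (t : ℕ)
    {ε : ℝ} (hε : ∀ x ∈ X, survivalError p d X 𝒯 (t * #𝒯) {x} ≤ ε) :
    #X * p * (3 * xi d - d * Real.exp (-t) - ε) ≤
      3 * bernoulliMean p X (fun A => (packingNumber 𝒯 A : ℝ)) := by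
  have removed := expected_removed_le_mul_packingNumber hp₀.le hp₁ X h𝒯
    (fun T hT => card_pos.1 (by simp [h.card_eq T hT])) (fun T hT => (h.card_eq T hT).le) (t * #𝒯)
  have alive := sum_le_card_nsmul X _ _ fun x hx =>
    h.survival_singleton_le h𝒯 hp₀ hd hdN t (hε x hx)
  rw [nsmul_eq_mul] at alive
  push_cast at removed
  linarith

theorem xi_sub_mul_le_bernoulliMean_packingNumber (h : IsRegularTripleSystem X 𝒯 D)
    (hp₀ : 0 < p) (hp₁ : p ≤ 1) (hd : d = D * p ^ 2) {q t K : ℕ} {ε : ℝ} (hdq : 27 * d + 1 ≤ q)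
    (hqN : (q : ℝ) ≤ #𝒯) (hdt : d * Real.exp (-t) ≤ ε) (hK : 1 < K) (hKε : (1 / 2) ^ K ≤ ε)
    (hE : stepError p d (#𝒯 : ℝ)⁻¹ (3 ^ (2 * q * t) * K) ≤ (1 / 2) ^ (3 ^ (2 * q * t) * K)) :
    (xi d - ε) * (#X * p) ≤ bernoulliMean p X (fun A => (packingNumber 𝒯 A : ℝ)) := by
  have hd₀ : 0 ≤ d := by rw [hd]; positivity
  have h𝒯 : 𝒯.Nonempty := card_pos.1 (by exact_mod_cast (by linarith : (0 : ℝ) < #𝒯))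
  have singleton_error (x) (hx : x ∈ X) : survivalError p d X 𝒯 (t * #𝒯) {x} ≤ ε :=
    (h.survivalError_mul_card_le_half_pow h𝒯 hp₀ hp₁ hd hdq (by exact_mod_cast hqN) t K hE
      (singleton_subset_iff.2 hx) (by simpa using hK)).trans hKε
  have hε : 0 ≤ ε := le_trans (by positivity) hKε
  have packing := h.le_three_mul_bernoulliMean_packingNumber h𝒯 hp₀ hp₁ hd (by linarith) t
    singleton_error
  have : #X * p * (3 * xi d - 3 * ε) ≤ #X * p * (3 * xi d - d * Real.exp (-t) - ε) :=
    mul_le_mul_of_nonneg_left (by linarith) (by positivity)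
  linarith

end IsRegularTripleSystem

theorem eventually_stepError_le (C : ℝ) (k : ℕ) {ε : ℝ} (hε : 0 < ε) :
    ∀ᶠ η in 𝓝[>] 0, stepError η C η k ≤ ε := by
  have : Continuous fun η => stepError η C η k := by unfold stepError; fun_prop
  exact ((this.tendsto' 0 0 (by simp [stepError])).eventually_le_const hε).filter_mono
    nhdsWithin_le_nhds

theorem exists_xi_sub_mul_le_bernoulliMean_packingNumber (C : ℝ) {ε : ℝ} (hε : 0 < ε) :
    ∃ η > (0 : ℝ), ∀ {α : Type*} [DecidableEq α] {X : Finset α} {𝒯 : Finset (Finset α)} {D : ℕ}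
      {p : ℝ}, IsRegularTripleSystem X 𝒯 D → η⁻¹ ≤ #𝒯 → 0 < p → p ≤ η → D * p ^ 2 ≤ C →
        (xi (D * p ^ 2) - ε) * (#X * p) ≤
          bernoulliMean p X (fun A => (packingNumber 𝒯 A : ℝ)) := by
  obtain ⟨t, ht⟩ : ∃ t : ℕ, C * Real.exp (-t) < ε := by
    have : Tendsto (fun t : ℕ => C * Real.exp (-t)) atTop (𝓝 (C * 0)) :=
      (Real.tendsto_exp_neg_atTop_nhds_zero.comp tendsto_natCast_atTop_atTop).const_mul C
    exact (this.eventually_lt_const (by simpa using hε)).exists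
  obtain ⟨K, hK, hKε⟩ : ∃ K, 1 < K ∧ (1 / 2 : ℝ) ^ K < ε :=
    ((eventually_gt_atTop 1).and ((tendsto_pow_atTop_nhds_zero_of_lt_one (by norm_num)
      (by norm_num : (1 / 2 : ℝ) < 1)).eventually_lt_const hε)).exists
  set q := ⌈27 * C + 1⌉₊
  set k := 3 ^ (2 * q * t) * K
  obtain ⟨η, hηE, hη₁, hη₀, hηq⟩ : ∃ η : ℝ, stepError η C η k ≤ (1 / 2) ^ k ∧ η ≤ 1 ∧
      0 < η ∧ η ≤ ((q + 1 : ℕ) : ℝ)⁻¹ :=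
    ((eventually_stepError_le C k (by positivity)).and
      ((eventually_nhdsWithin_of_eventually_nhds (eventually_le_nhds one_pos)).and
        (Ioc_mem_nhdsGT (by positivity)))).exists
  refine ⟨η, hη₀, fun {α _ X 𝒯 D p} h hN hp₀ hpη hdC => ?_⟩
  have hdq : 27 * (D * p ^ 2) + 1 ≤ q := le_trans (by gcongr) (Nat.le_ceil _)
  have hqN : (q : ℝ) ≤ #𝒯 :=
    calc (q : ℝ) ≤ (q + 1 : ℕ) := by simp
      _ ≤ η⁻¹ := (le_inv_comm₀ (by positivity) hη₀).2 hηq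
      _ ≤ #𝒯 := hN
  refine h.xi_sub_mul_le_bernoulliMean_packingNumber hp₀ (hpη.trans hη₁) rfl hdq hqN
    (le_trans (by gcongr) ht.le) hK hKε.le (le_trans ?_ hηE)
  have := inv_le_of_inv_le₀ hη₀ hN
  unfold stepError
  gcongr

end TimeBlocks

section GraphTriangles

open Finset

variable {V : Type*} [DecidableEq V]

/-- The pairs of distinct elements of `s`, that is, the edges of the complete graph on `s`. -/
def pairsOf (s : Finset V) : Finset (Sym2 V) := s.offDiag.image Sym2.mk.uncurry

theorem mk_mem_pairsOf {s : Finset V} {x y : V} :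
    s(x, y) ∈ pairsOf s ↔ x ∈ s ∧ y ∈ s ∧ x ≠ y := by
  simp only [pairsOf, mem_image, mem_offDiag, Prod.exists, Function.uncurry_apply_pair,
    Sym2.eq_iff]
  grind

theorem card_pairsOf (s : Finset V) : #(pairsOf s) = (#s).choose 2 := Sym2.card_image_offDiag s

theorem pairsOf_mono {s t : Finset V} (h : s ⊆ t) : pairsOf s ⊆ pairsOf t :=
  image_subset_image (offDiag_mono h)

theorem pairsOf_inter (s t : Finset V) : pairsOf (s ∩ t) = pairsOf s ∩ pairsOf t := by
  ext e
  induction e with | _ x y =>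
  simp only [mem_inter, mk_mem_pairsOf]
  tauto

theorem card_pairsOf_inter_pairsOf_le {s t : Finset V} (hs : #s = 3) (ht : #t = 3)
    (hst : s ≠ t) : #(pairsOf s ∩ pairsOf t) ≤ 1 := by
  have card_inter_lt : #(s ∩ t) < 3 := by
    refine hs ▸ card_lt_card (inter_subset_left.ssubset_of_ne fun h => hst ?_)
    exact eq_of_subset_of_card_le (inter_eq_left.1 h) (ht.trans hs.symm).le
  rw [← pairsOf_inter, card_pairsOf]
  exact Nat.choose_le_choose 2 (Nat.le_of_lt_succ card_inter_lt)

theorem pairsOf_injOn : Set.InjOn (pairsOf (V := V)) {s | #s = 3} := fun s hs t ht hst => by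
  by_contra hne
  have := card_pairsOf_inter_pairsOf_le hs ht hne
  rw [← hst, inter_self, card_pairsOf, show #s = 3 from hs] at this
  exact absurd this (by decide)

theorem mk_mem_pairsOf_iff_subset {s : Finset V} {x y : V} (hxy : x ≠ y) :
    s(x, y) ∈ pairsOf s ↔ {x, y} ⊆ s := by
  simp [mk_mem_pairsOf, insert_subset_iff, hxy]

variable (V) in
/-- The edge sets of the triangles of the complete graph on `V`. -/
def triangleTriples [Fintype V] : Finset (Finset (Sym2 V)) :=
  ((univ : Finset V).powersetCard 3).image pairsOf

theorem pairsOf_injOn_powersetCard (s : Finset V) :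
    Set.InjOn (pairsOf (V := V)) (s.powersetCard 3) :=
  pairsOf_injOn.mono fun _ ht => (mem_powersetCard.1 ht).2

theorem mem_triangleTriples [Fintype V] {T : Finset (Sym2 V)} :
    T ∈ triangleTriples V ↔ ∃ t : Finset V, #t = 3 ∧ pairsOf t = T := by
  simp [triangleTriples, mem_powersetCard]

theorem card_triangleTriples [Fintype V] : #(triangleTriples V) = (Fintype.card V).choose 3 := by
  rw [triangleTriples, card_image_of_injOn (pairsOf_injOn_powersetCard _), card_powersetCard,
    card_univ]

theorem card_filter_mem_triangleTriples [Fintype V] {e : Sym2 V}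
    (he : e ∈ pairsOf (univ : Finset V)) :
    #{T ∈ triangleTriples V | e ∈ T} = Fintype.card V - 2 := by
  induction e with | _ x y =>
  have hxy : x ≠ y := (mk_mem_pairsOf.1 he).2.2
  have hcard : #({x, y} : Finset V) = 2 := card_pair hxy
  rw [triangleTriples, filter_image, card_image_of_injOn
    ((pairsOf_injOn_powersetCard _).mono (filter_subset _ _))]
  simp only [mk_mem_pairsOf_iff_subset hxy]
  rw [card_filter_powersetCard_subset _ _ _ (subset_univ _) (by omega), hcard, card_univ,
    Nat.choose_one_right]

variable (V) in
theorem isRegularTripleSystem_triangleTriples [Fintype V] :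
    IsRegularTripleSystem (pairsOf (univ : Finset V)) (triangleTriples V)
      (Fintype.card V - 2) where
  card_eq T hT := by
    obtain ⟨t, ht, rfl⟩ := mem_triangleTriples.1 hT
    rw [card_pairsOf, ht, Nat.choose_succ_self_right]
  pairwise_card_inter_le T hT T' hT' hne := by
    obtain ⟨t, ht, rfl⟩ := mem_triangleTriples.1 hT
    obtain ⟨t', ht', rfl⟩ := mem_triangleTriples.1 hT'
    exact card_pairsOf_inter_pairsOf_le ht ht' fun h => hne (h ▸ rfl)
  subset T hT := by
    obtain ⟨t, -, rfl⟩ := mem_triangleTriples.1 hT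
    exact pairsOf_mono (subset_univ t)
  degree _ he := card_filter_mem_triangleTriples he

theorem isNClique_fromEdgeSet {A : Finset (Sym2 V)} {t : Finset V} (h : pairsOf t ⊆ A) :
    (SimpleGraph.fromEdgeSet (A : Set (Sym2 V))).IsNClique #t t :=
  ⟨fun _ hx _ hy hxy =>
    (SimpleGraph.fromEdgeSet_adj _).2 ⟨h (mk_mem_pairsOf.2 ⟨hx, hy, hxy⟩), hxy⟩, rfl⟩

theorem subsingleton_inter_of_disjoint_pairsOf {s t : Finset V}
    (h : Disjoint (pairsOf s) (pairsOf t)) : ((s : Set V) ∩ (t : Set V)).Subsingleton := by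
  rw [disjoint_iff_inter_eq_empty, ← pairsOf_inter, ← card_eq_zero, card_pairsOf,
    Nat.choose_eq_zero_iff] at h
  rw [← coe_inter, ← card_le_one_iff_subsingleton]
  omega

theorem packingNumber_triangleTriples_le [Fintype V] (A : Finset (Sym2 V)) :
    packingNumber (triangleTriples V) A ≤
      (SimpleGraph.fromEdgeSet (A : Set (Sym2 V))).triangleMatchingNumber := by
  obtain ⟨M, hM, hcard⟩ := exists_isPacking_card_eq (triangleTriples V) A
  set N : Finset (Finset V) := {t ∈ univ.powersetCard 3 | pairsOf t ∈ M}
  have card_eq_three : ∀ t ∈ N, #t = 3 := fun t ht =>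
    (mem_powersetCard.1 (mem_filter.1 ht).1).2
  have pairsOf_mem : ∀ t ∈ N, pairsOf t ∈ M := fun t ht => (mem_filter.1 ht).2
  have hinj : Set.InjOn pairsOf (N : Set (Finset V)) := pairsOf_injOn.mono card_eq_three
  have himage : N.image pairsOf = M := by
    refine Subset.antisymm (image_subset_iff.2 pairsOf_mem) fun T hT => ?_
    obtain ⟨t, ht, rfl⟩ := mem_triangleTriples.1 (hM.subset hT)
    exact mem_image_of_mem _ (mem_filter.2 ⟨by simpa [mem_powersetCard] using ht, hT⟩)
  rw [← hcard, ← himage, card_image_of_injOn hinj]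
  refine (SimpleGraph.isGreatest_triangleMatchingNumber _).2 ⟨N, ⟨fun t ht => ?_, ?_⟩, rfl⟩
  · exact card_eq_three t ht ▸ isNClique_fromEdgeSet (hM.subset_of_mem _ (pairsOf_mem t ht))
  · exact fun s hs t ht hst => subsingleton_inter_of_disjoint_pairsOf <|
      hM.pairwiseDisjoint (pairsOf_mem s hs) (pairsOf_mem t ht) (hinj.ne hs ht hst)

end GraphTriangles

section BinomialRandomGraph

open Finset

variable {V : Type*} [DecidableEq V] [Fintype V]

theorem mem_pairsOf_univ {e : Sym2 V} : e ∈ pairsOf (univ : Finset V) ↔ ¬e.IsDiag := by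
  induction e with | _ x y => simp [mk_mem_pairsOf]

theorem edgeSet_fromEdgeSet_of_subset_pairsOf_univ {A : Finset (Sym2 V)} (hA : A ⊆ pairsOf univ) :
    (SimpleGraph.fromEdgeSet (A : Set (Sym2 V))).edgeSet = A := by
  rw [SimpleGraph.edgeSet_fromEdgeSet, sdiff_eq_left, Set.disjoint_left]
  exact fun e he hdiag => mem_pairsOf_univ.1 (hA he) (Sym2.mem_diagSet.1 hdiag)

theorem bijOn_fromEdgeSet_powerset_pairsOf_univ :
    Set.BijOn (fun A : Finset (Sym2 V) => SimpleGraph.fromEdgeSet (A : Set (Sym2 V)))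
      (pairsOf (univ : Finset V)).powerset Set.univ := by
  classical
  refine ⟨Set.mapsTo_univ _ _, fun A hA B hB hAB => ?_, fun G _ => ?_⟩
  · rw [← coe_inj, ← edgeSet_fromEdgeSet_of_subset_pairsOf_univ (mem_powerset.1 hA),
      ← edgeSet_fromEdgeSet_of_subset_pairsOf_univ (mem_powerset.1 hB)]
    exact congrArg _ hAB
  · refine ⟨G.edgeFinset, mem_coe.2 (mem_powerset.2 fun e he => ?_), by simp⟩
    exact mem_pairsOf_univ.2 (G.not_isDiag_of_mem_edgeSet (SimpleGraph.mem_edgeFinset.1 he))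

theorem binomialRandom_real_singleton_fromEdgeSet (p : unitInterval) {A : Finset (Sym2 V)}
    (hA : A ⊆ pairsOf univ) :
    (SimpleGraph.binomialRandom V p).real {SimpleGraph.fromEdgeSet (A : Set (Sym2 V))} =
      (p : ℝ) ^ #A * (1 - p) ^ #(pairsOf univ \ A) := by
  rw [MeasureTheory.measureReal_def, SimpleGraph.binomialRandom_singleton,
    edgeSet_fromEdgeSet_of_subset_pairsOf_univ hA, Set.ncard_coe_finset,
    card_sdiff_of_subset hA, card_pairsOf, card_univ, Nat.card_eq_fintype_card]
  simp

theorem binomialRandom_real_eq_bernoulliMean (p : unitInterval) (S : Set (SimpleGraph V)) :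
    (SimpleGraph.binomialRandom V p).real S =
      bernoulliMean p (pairsOf univ)
        (fun A : Finset (Sym2 V) =>
          S.indicator 1 (SimpleGraph.fromEdgeSet (A : Set (Sym2 V)))) := by
  classical
  have : MeasurableSingletonClass (SimpleGraph V) := ⟨fun G => by
    rw [← SimpleGraph.edgeSet_injective.preimage_image {G}, Set.image_singleton]
    exact SimpleGraph.measurable_edgeSet (measurableSet_singleton _)⟩
  have sum_singleton : (SimpleGraph.binomialRandom V p).real S =
      ∑ G, (SimpleGraph.binomialRandom V p).real {G} * S.indicator 1 G := by
    conv_lhs => rw [← Set.coe_toFinset S, ← MeasureTheory.sum_measureReal_singleton]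
    simp [Set.indicator_apply, sum_ite]
  rw [sum_singleton, bernoulliMean_apply]
  refine (sum_nbij _ (fun _ _ => mem_univ _) bijOn_fromEdgeSet_powerset_pairsOf_univ.injOn
    (by simpa using bijOn_fromEdgeSet_powerset_pairsOf_univ.surjOn) fun A hA => ?_).symm
  rw [binomialRandom_real_singleton_fromEdgeSet p (mem_powerset.1 hA)]

theorem le_binomialRandom_real_lt_triangleMatchingNumber (p : unitInterval) {x s : ℝ} (hs : 0 < s)
    (hx : x + s ≤ bernoulliMean p (pairsOf (univ : Finset V))
      (fun A => (packingNumber (triangleTriples V) A : ℝ))) :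
    1 - #(pairsOf (univ : Finset V)) * (p : ℝ) / s ^ 2 ≤
      (SimpleGraph.binomialRandom V p).real {G | x < G.triangleMatchingNumber} := by
  obtain ⟨p, hp₀, hp₁⟩ := p
  rw [binomialRandom_real_eq_bernoulliMean]
  dsimp only at hx ⊢
  set X := pairsOf (univ : Finset V)
  set ν := fun A => (packingNumber (triangleTriples V) A : ℝ)
  have variance_le : bernoulliVariance p X ν ≤ #X * p := by
    have efron_stein := bernoulliVariance_le_efronStein hp₀ hp₁ X (F := ν) (c := 1)
      fun e _ A _ => abs_packingNumber_insert_sub_le e A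
    simp only [Pi.one_apply, one_pow, sum_const, nsmul_one] at efron_stein
    nlinarith [mul_nonneg (mul_nonneg hp₀ hp₀) (Nat.cast_nonneg (α := ℝ) #X)]
  have tail := (bernoulliMean_lower_tail_le_chebyshev hp₀ hp₁ X ν hs).trans
    (div_le_div_of_nonneg_right variance_le (sq_nonneg s))
  calc 1 - #X * p / s ^ 2
      ≤ bernoulliMean p X ((fun _ => 1) - Set.indicator {A | ν A ≤ bernoulliMean p X ν - s} 1) := by
        rw [map_sub, bernoulliMean_const]
        exact sub_le_sub_left tail 1
    _ ≤ _ := bernoulliMean_mono hp₀ hp₁ fun A _ => ?_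
  have le_matching : ν A ≤ (SimpleGraph.fromEdgeSet (A : Set (Sym2 V))).triangleMatchingNumber :=
    Nat.cast_le.2 (packingNumber_triangleTriples_le A)
  by_cases hA : ν A ≤ bernoulliMean p X ν - s
  · refine le_trans (b := 0) ?_ (Set.indicator_nonneg (fun _ _ => zero_le_one) _)
    simp [hA]
  · have hlt : x < (SimpleGraph.fromEdgeSet (A : Set (Sym2 V))).triangleMatchingNumber := by
      linarith
    simp [hA, hlt]

end BinomialRandomGraph

section Xi

theorem monotoneOn_xi : MonotoneOn xi (Set.Ici 0) := fun x hx y hy hxy => by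
  have sqrt_le : √(1 + 2 * x) ≤ √(1 + 2 * y) := Real.sqrt_le_sqrt (by linarith)
  have sqrt_pos : 0 < √(1 + 2 * x) := Real.sqrt_pos.2 (by linarith [Set.mem_Ici.1 hx])
  linarith [one_sub_three_mul_xi hx, one_sub_three_mul_xi hy, inv_anti₀ sqrt_pos sqrt_le]

theorem xi_pos {x : ℝ} (hx : 0 < x) : 0 < xi x := by
  have one_lt_sqrt : 1 < √(1 + 2 * x) := Real.lt_sqrt_of_sq_lt (by linarith)
  linarith [one_sub_three_mul_xi hx.le, inv_lt_one_of_one_lt₀ one_lt_sqrt]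

end Xi

section Asymptotics

theorem exists_tendsto_zero_and_eventually_of_forall_eventually {Q : ℕ → ℝ → Prop}
    (hQ : ∀ ε > 0, ∀ᶠ n in atTop, Q n ε) :
    ∃ δ : ℕ → ℝ, Tendsto δ atTop (𝓝 0) ∧ ∀ᶠ n in atTop, Q n (δ n) := by
  classical
  set k : ℕ → ℕ := fun n => Nat.findGreatest (fun k => Q n (1 / ((k : ℝ) + 1))) n
  have tendsto_k : Tendsto k atTop atTop := tendsto_atTop.2 fun K => by
    filter_upwards [hQ _ Nat.one_div_pos_of_nat, eventually_ge_atTop K] with n hn hKn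
    exact Nat.le_findGreatest hKn hn
  refine ⟨fun n => 1 / ((k n : ℝ) + 1), tendsto_one_div_add_atTop_nhds_zero_nat.comp tendsto_k, ?_⟩
  filter_upwards [hQ _ (Nat.one_div_pos_of_nat (n := 0))] with n hn
  exact Nat.findGreatest_spec (P := fun k => Q n (1 / ((k : ℝ) + 1))) n.zero_le hn

variable {p : ℕ → ℝ}

theorem exists_eventually_expectedTrianglesOnEdge_mem_Icc
    (hd : (fun n : ℕ => expectedTrianglesOnEdge n (p n)) =Θ[atTop] (fun _ : ℕ => (1 : ℝ))) :
    ∃ c > 0, ∃ C, ∀ᶠ n in atTop, expectedTrianglesOnEdge n (p n) ∈ Set.Icc c C := by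
  obtain ⟨C, hC⟩ := hd.1.bound
  obtain ⟨B, hB₀, hB⟩ := hd.2.exists_pos
  refine ⟨B⁻¹, inv_pos.2 hB₀, C, ?_⟩
  filter_upwards [hC, hB.bound, eventually_ge_atTop 2] with n hnC hnB hn
  have nonneg : 0 ≤ expectedTrianglesOnEdge n (p n) :=
    mul_nonneg (sub_nonneg.2 (by exact_mod_cast hn)) (sq_nonneg _)
  rw [Real.norm_of_nonneg nonneg, norm_one] at hnB hnC
  exact ⟨(inv_le_iff_one_le_mul₀' hB₀).2 hnB, by simpa using hnC⟩

theorem tendsto_natCast_sub_two_atTop : Tendsto (fun n : ℕ => (n : ℝ) - 2) atTop atTop :=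
  tendsto_atTop_add_const_right _ _ tendsto_natCast_atTop_atTop

theorem tendsto_zero_of_expectedTrianglesOnEdge_le (hp₀ : ∀ n, 0 ≤ p n) {C : ℝ}
    (hC : ∀ᶠ n in atTop, expectedTrianglesOnEdge n (p n) ≤ C) : Tendsto p atTop (𝓝 0) := by
  have sq_tendsto : Tendsto (fun n => p n ^ 2) atTop (𝓝 0) := by
    refine squeeze_zero' (.of_forall fun n => sq_nonneg _) ?_
      (tendsto_natCast_sub_two_atTop.const_div_atTop C)
    filter_upwards [hC, tendsto_natCast_sub_two_atTop.eventually_gt_atTop 0] with n hn hpos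
    rwa [le_div_iff₀' hpos]
  simpa [Real.sqrt_sq (hp₀ _)] using sq_tendsto.sqrt

theorem tendsto_expectedEdges_atTop (hp₀ : ∀ n, 0 ≤ p n) (hp₁ : ∀ n, p n ≤ 1) {c : ℝ} (hc : 0 < c)
    (hcd : ∀ᶠ n in atTop, c ≤ expectedTrianglesOnEdge n (p n)) :
    Tendsto (fun n => expectedEdges n (p n)) atTop atTop := by
  refine tendsto_atTop_mono' _ ?_ (tendsto_natCast_sub_two_atTop.const_mul_atTop (half_pos hc))
  filter_upwards [hcd, tendsto_natCast_sub_two_atTop.eventually_gt_atTop 0] with n hn hpos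
  have le_mul : c ≤ n * p n :=
    calc c ≤ (n - 2) * p n ^ 2 := hn
      _ ≤ n * p n := mul_le_mul (by linarith) (pow_le_of_le_one (hp₀ n) (hp₁ n) two_ne_zero)
        (sq_nonneg _) n.cast_nonneg
  calc c / 2 * (n - 2) ≤ n * p n / 2 * (n - 1) := by
        refine mul_le_mul ?_ ?_ hpos.le ?_ <;> linarith
    _ = expectedEdges n (p n) := by rw [expectedEdges, Nat.cast_choose_two]; ring

theorem tendsto_natCast_choose_atTop {k : ℕ} (hk : k ≠ 0) :
    Tendsto (fun n : ℕ => (n.choose k : ℝ)) atTop atTop :=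
  (isEquivalent_choose k).symm.tendsto_atTop <|
    ((tendsto_pow_atTop hk).comp tendsto_natCast_atTop_atTop).atTop_div_const (by positivity)

theorem card_pairsOf_univ_mul (n : ℕ) (p : ℝ) :
    (pairsOf (Finset.univ : Finset (Fin n))).card * p = expectedEdges n p := by
  rw [card_pairsOf, Finset.card_univ, Fintype.card_fin, expectedEdges]

theorem card_sub_two_mul_sq {n : ℕ} (hn : 2 ≤ n) (p : ℝ) :
    ((Fintype.card (Fin n) - 2 : ℕ) : ℝ) * p ^ 2 = expectedTrianglesOnEdge n p := by
  rw [Fintype.card_fin, Nat.cast_sub hn, expectedTrianglesOnEdge, Nat.cast_two]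

theorem one_sub_le_binomialRandom_real_of_le_bernoulliMean {n : ℕ} {p : unitInterval} {c ε : ℝ}
    (hc : 0 < c) (hε : 0 < ε) (hcd : c ≤ expectedTrianglesOnEdge n p)
    (hm : ((xi c * ε / 2) ^ 2 * ε)⁻¹ ≤ expectedEdges n p)
    (hmean : (xi (expectedTrianglesOnEdge n p) - xi c * ε / 2) * expectedEdges n p ≤
      bernoulliMean p (pairsOf Finset.univ)
        (fun A => (packingNumber (triangleTriples (Fin n)) A : ℝ))) :
    1 - ε ≤ (SimpleGraph.binomialRandom (Fin n) p).real
      {G | (1 - ε) * xi (expectedTrianglesOnEdge n p) * expectedEdges n p <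
        G.triangleMatchingNumber} := by
  set m := expectedEdges n p
  set d := expectedTrianglesOnEdge n p
  have xi_le : xi c ≤ xi d := monotoneOn_xi hc.le (hc.le.trans hcd) hcd
  have xi_c_pos := xi_pos hc
  have m_pos : 0 < m := (by positivity : 0 < ((xi c * ε / 2) ^ 2 * ε)⁻¹).trans_le hm
  have target_add_le : (1 - ε) * xi d * m + xi c * ε / 2 * m ≤ (xi d - xi c * ε / 2) * m := by
    have := mul_le_mul_of_nonneg_left xi_le hε.le
    rw [← add_mul]
    gcongr
    linarith
  calc 1 - ε ≤ 1 - (pairsOf (Finset.univ : Finset (Fin n))).card * p / (xi c * ε / 2 * m) ^ 2 := by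
        rw [card_pairsOf_univ_mul, sub_le_sub_iff_left, mul_pow, div_le_iff₀ (by positivity)]
        rw [inv_le_iff_one_le_mul₀ (by positivity)] at hm
        linarith [mul_le_mul_of_nonneg_left hm m_pos.le]
    _ ≤ _ := le_binomialRandom_real_lt_triangleMatchingNumber p (by positivity)
        (target_add_le.trans hmean)

theorem eventually_one_sub_le_binomialRandom_real {p : ℕ → unitInterval} {c C : ℝ} (hc : 0 < c)
    (hd : ∀ᶠ n in atTop, expectedTrianglesOnEdge n (p n) ∈ Set.Icc c C) {ε : ℝ} (hε : 0 < ε) :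
    ∀ᶠ n in atTop, 1 - ε ≤ (SimpleGraph.binomialRandom (Fin n) (p n)).real
      {G | (1 - ε) * xi (expectedTrianglesOnEdge n (p n)) * expectedEdges n (p n) <
        G.triangleMatchingNumber} := by
  have xi_c_pos := xi_pos hc
  obtain ⟨η, hη, le_mean⟩ := exists_xi_sub_mul_le_bernoulliMean_packingNumber C
    (by positivity : 0 < xi c * ε / 2)
  have p_tendsto := tendsto_zero_of_expectedTrianglesOnEdge_le (fun n => (p n).2.1)
    (hd.mono fun _ h => h.2)
  have edges_tendsto := tendsto_expectedEdges_atTop (fun n => (p n).2.1) (fun n => (p n).2.2) hc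
    (hd.mono fun _ h => h.1)
  filter_upwards [hd, p_tendsto.eventually_le_const hη, eventually_ge_atTop 2,
    (tendsto_natCast_choose_atTop three_ne_zero).eventually_ge_atTop η⁻¹,
    edges_tendsto.eventually_ge_atTop ((xi c * ε / 2) ^ 2 * ε)⁻¹] with n ⟨hcd, hdC⟩ hpη hn hN hm
  refine one_sub_le_binomialRandom_real_of_le_bernoulliMean hc hε hcd hm ?_
  have p_pos : (0 : ℝ) < p n := (p n).2.1.lt_of_ne' fun h => by
    rw [expectedTrianglesOnEdge, h] at hcd
    linarith
  rw [← card_pairsOf_univ_mul, ← card_sub_two_mul_sq hn]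
  refine le_mean (isRegularTripleSystem_triangleTriples (Fin n)) ?_ p_pos hpη ?_
  · rwa [card_triangleTriples, Fintype.card_fin]
  · rwa [card_sub_two_mul_sq hn]

end Asymptotics

theorem mainTheorem3 (p : ℕ → unitInterval)
    (hd : (fun n : ℕ => expectedTrianglesOnEdge n (p n : ℝ)) =Θ[atTop] (fun _ : ℕ => (1 : ℝ))) :
    ∃ δ : ℕ → ℝ, Tendsto δ atTop (𝓝 0) ∧
      Tendsto
        (fun n : ℕ => (SimpleGraph.binomialRandom (Fin n) (p n))
          {G : SimpleGraph (Fin n) |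
            (1 - δ n) * xi (expectedTrianglesOnEdge n (p n : ℝ)) * expectedEdges n (p n : ℝ)
              < (G.triangleMatchingNumber : ℝ)})
        atTop (𝓝 1) := by
  obtain ⟨c, hc, C, hbounds⟩ := exists_eventually_expectedTrianglesOnEdge_mem_Icc hd
  obtain ⟨δ, hδ, hprob⟩ := exists_tendsto_zero_and_eventually_of_forall_eventually fun _ hε =>
    eventually_one_sub_le_binomialRandom_real hc hbounds hε
  refine ⟨δ, hδ, ?_⟩
  rw [← ENNReal.tendsto_toReal_iff (fun _ => MeasureTheory.measure_ne_top _ _) ENNReal.one_ne_top]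
  exact tendsto_of_tendsto_of_tendsto_of_le_of_le' (by simpa using hδ.const_sub 1)
    tendsto_const_nhds hprob (.of_forall fun _ => MeasureTheory.measureReal_le_one)
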